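/- Let $n\ge 1$, $A\in\mathbb C^{n\times n}$, and for $u,v\in\mathbb C^n$, $t>0$ put $$\sigma(A,u,v;t)=\bigcup_{0\le\theta<2\pi}\sigma(A+te^{i\theta}uv^*),\qquad Q(\lambda)=v^*(\lambda I_n-A)^{-1}u .$$ $Q$ is regarded as a rational function in reduced form, i.e. with removable singularities removed. Let $L_t=\{z\in\mathbb C: z \text{ is not a pole of } Q,\ 1/|Q(z)|=t\}$, and let $F$ be the set of frozen eigenvalues, i.e. those $z$ that are eigenvalues of $A+\tau uv^*$ for every $\tau\in\mathbb C$ (a subset of $\sigma(A)$ that does not depend on $t$). Let the $z_j$ be the zeros of $Q'$ (among the non-poles of $Q$) and $t_j=1/|Q(z_j)|$ (if $Q(z_j)=0$, then $t_j=\infty$ and the condition $t\ne t_j$ is empty). A smooth closed curve is a $\mathcal C^\infty$-diffeomorphic image of a circle. For all nonzero $u,v\in\mathbb C^n$: (o) For every $t>0$, $\sigma(A,u,v;t)=L_t\cup F$ (so $\sigma(A,u,v;t)=L_t$ if there are no frozen eigenvalues), and $L_t$ is the zero set in $\mathbb C=\mathbb R^2$ of a nonzero real polynomial in two variables. (i)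 If $t>0$ and $t\neq t_j$ for all $j$, then $L_t$ is the union of finitely many pairwise disjoint smooth closed curves. (ii) For every $t>0$ (in particular for $t=t_j$), near each of its points that is not one of the $z_i$ the set $L_t$ is a smooth embedded arc, i.e. locally diffeomorphic with an interval. Each $z_i\in L_t$ is an intersection point: near $z_i$ the set $L_t$ is the union of $k\ge 2$ smooth embedded arcs through $z_i$, any two of which meet only at $z_i$ and are not tangent there. (iv) $\displaystyle\sigma(A)\cup\bigcup_{t>0}\sigma(A,u,v;t)\cup Q^{-1}(0)=\mathbb C$. (v) For $t>0$ the set $\sigma(A,u,v;t)$ is nonempty and compact, and $t\mapsto\sigma(A,u,v;t)$ is continuous in the Hausdorff metric on $(0,\infty)$. (vi) If $Q\not\equiv 0$, then, as $t\to\infty$, in the Hausdorff sense on the Riemann sphere $\mathbb C\cup\{\infty\}$, $L_t$ converges to $Q^{-1}(0)\cup\{\infty\}$ and $\sigma(A,u,v;t)$ converges to $Q^{-1}(0)\cup F\cup\{\infty\}$. Moreover: (iii) For generic $u,\bar v$ (that is, there is a nonzero complex polynomial in $2n$ variables, depending on $A$, such that the following holds for all $u,v\in\mathbb C^n$ for which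 the polynomial does not vanish at $(u,\bar v)$), every zero $z_j$ of $Q'$ satisfies $Q(z_j)\ne0$ and is an eigenvalue of $A+\tau uv^*$ with $\tau=1/Q(z_j)$ of algebraic multiplicity exactly two; and near $z_j$ the set $\sigma(A,u,v;t_j)$ is the union of two simple curves that meet only at $z_j$. Each of the two consists of two arcs, smooth up to $z_j$, that form a right-angle corner at $z_j$ (so the curve is not differentiable there), and the two curves meet at right angles: for some $w\neq0$ the directions in which the four arcs leave $z_j$ are $w,iw$ (first curve) and $-w,-iw$ (second curve). -/

import Mathlib

open Set Filter Topology
open scoped ContDiff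

noncomputable section

namespace RankOne

/-! ### Rank-one perturbations and the transfer function -/

/-- The matrix `A + τ u v^*`. -/
def perturb {n : ℕ} (A : Matrix (Fin n) (Fin n) ℂ) (u v : Fin n → ℂ) (τ : ℂ) :
    Matrix (Fin n) (Fin n) ℂ :=
  A + τ • Matrix.vecMulVec u (star v)

/-- `σ(A,u,v;t)`: the union over `θ ∈ [0, 2π)` of the spectra of `A + t e^{iθ} u v^*`. -/
def sigma {n : ℕ} (A : Matrix (Fin n) (Fin n) ℂ) (u v : Fin n → ℂ) (t : ℝ) : Set ℂ :=
  ⋃ θ ∈ Ico (0 : ℝ) (2 * Real.pi),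
    spectrum ℂ (perturb A u v ((t : ℂ) * Complex.exp ((θ : ℂ) * Complex.I)))

/-- The frozen eigenvalues: the common eigenvalues of all the matrices `A + τ u v^*`, `τ ∈ ℂ`. -/
def frozen {n : ℕ} (A : Matrix (Fin n) (Fin n) ℂ) (u v : Fin n → ℂ) : Set ℂ :=
  {z | ∀ τ : ℂ, z ∈ spectrum ℂ (perturb A u v τ)}

/-- The rational function `Q(λ) = v^* (λ I - A)⁻¹ u`, as an element of `ℂ(λ)`; the matrix is
inverted over the field `ℂ(λ)`, where its determinant (the characteristic polynomial) is nonzero. -/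
def Q {n : ℕ} (A : Matrix (Fin n) (Fin n) ℂ) (u v : Fin n → ℂ) : RatFunc ℂ :=
  (fun i => RatFunc.C (star (v i))) ⬝ᵥ
    (((RatFunc.X : RatFunc ℂ) • (1 : Matrix (Fin n) (Fin n) (RatFunc ℂ))
        - A.map (RatFunc.C : ℂ →+* RatFunc ℂ))⁻¹.mulVec (fun i => RatFunc.C (u i)))

/-- `z` is not a pole of `Q` (the denominator is that of the reduced fraction, so removable
singularities have been removed). -/
def Regular {n : ℕ} (A : Matrix (Fin n) (Fin n) ℂ) (u v : Fin n → ℂ) (z : ℂ) : Prop :=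
  (Q A u v).denom.eval z ≠ 0

/-- The value `Q(z)`; meaningful where `Q` has no pole. -/
def Qval {n : ℕ} (A : Matrix (Fin n) (Fin n) ℂ) (u v : Fin n → ℂ) (z : ℂ) : ℂ :=
  (Q A u v).eval (RingHom.id ℂ) z

/-- `Q⁻¹(0)`. -/
def zerosQ {n : ℕ} (A : Matrix (Fin n) (Fin n) ℂ) (u v : Fin n → ℂ) : Set ℂ :=
  {z | Regular A u v z ∧ Qval A u v z = 0}

/-- The zeros of `Q'` (the points `z_j`). -/
def critical {n : ℕ} (A : Matrix (Fin n) (Fin n) ℂ) (u v : Fin n → ℂ) : Set ℂ :=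
  {z | Regular A u v z ∧ deriv (Qval A u v) z = 0}

/-- The level set `{1/|Q| = t}`. -/
def level {n : ℕ} (A : Matrix (Fin n) (Fin n) ℂ) (u v : Fin n → ℂ) (t : ℝ) : Set ℂ :=
  {z | Regular A u v z ∧ 1 / ‖Qval A u v z‖ = t}

/-! ### Curves in the plane -/

/-- `C` is a `C^∞`-diffeomorphic image of a circle: the image of a `2π`-periodic smooth regular
curve that is injective on a period. -/
def IsSmoothClosedCurve (C : Set ℂ) : Prop :=
  ∃ γ : ℝ → ℂ, ContDiff ℝ ∞ γ ∧ Function.Periodic γ (2 * Real.pi) ∧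
    InjOn γ (Ico 0 (2 * Real.pi)) ∧ (∀ s, deriv γ s ≠ 0) ∧ range γ = C

/-- `S` is a real algebraic curve in `ℂ = ℝ²`: the zero set of a nonzero real polynomial in the
real and imaginary part. -/
def IsAlgebraicCurve (S : Set ℂ) : Prop :=
  ∃ P : MvPolynomial (Fin 2) ℝ, P ≠ 0 ∧
    S = {z : ℂ | MvPolynomial.eval ![z.re, z.im] P = 0}

/-- The restriction of `γ` to the compact interval `[a, b]` is smooth (up to the end points), with
nowhere vanishing derivative. -/
def IsRegularOn (γ : ℝ → ℂ) (a b : ℝ) : Prop :=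
  ContDiffOn ℝ ∞ γ (Icc a b) ∧ ∀ s ∈ Icc a b, derivWithin γ (Icc a b) s ≠ 0

/-- `γ` restricted to `[-1, 1]` is a `C^∞` embedded arc that passes through `z` at time `0`. -/
def IsSmoothArcThrough (γ : ℝ → ℂ) (z : ℂ) : Prop :=
  IsRegularOn γ (-1) 1 ∧ InjOn γ (Icc (-1) 1) ∧ γ 0 = z

/-- `S` is, near its point `z`, diffeomorphic with an interval: a smooth embedded arc with `z` in
its interior lies in `S` and fills a neighbourhood of `z` in `S`. -/
def IsLocallyInterval (S : Set ℂ) (z : ℂ) : Prop :=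
  ∃ γ : ℝ → ℂ, IsSmoothArcThrough γ z ∧ γ '' Icc (-1) 1 ⊆ S ∧ γ '' Icc (-1) 1 ∈ 𝓝[S] z

/-- `z` is an intersection point of `S`: near `z` the set `S` consists of `k ≥ 2` smooth embedded
arcs through `z`, any two of which have only `z` in common and are not tangent there. -/
def IsCrossing (S : Set ℂ) (z : ℂ) : Prop :=
  ∃ (k : ℕ) (γ : Fin k → ℝ → ℂ), 2 ≤ k ∧
    (∀ i, IsSmoothArcThrough (γ i) z) ∧
    (∀ i j, i ≠ j → γ i '' Icc (-1) 1 ∩ γ j '' Icc (-1) 1 = {z}) ∧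
    (∀ i j, i ≠ j → LinearIndependent ℝ ![deriv (γ i) 0, deriv (γ j) 0]) ∧
    (⋃ i, γ i '' Icc (-1) 1) ⊆ S ∧ (⋃ i, γ i '' Icc (-1) 1) ∈ 𝓝[S] z

/-- `γ` restricted to `[-1, 1]` is a simple curve made of two arcs, smooth up to their common end
point `z = γ 0`, which form a right angle there: the arc on `[0, 1]` leaves `z` in the direction
`w ≠ 0`, and the arc on `[-1, 0]`, run backwards, leaves `z` in the direction `i w`. -/
def IsRightAngleCorner (γ : ℝ → ℂ) (z w : ℂ) : Prop :=
  w ≠ 0 ∧ γ 0 = z ∧ InjOn γ (Icc (-1) 1) ∧ IsRegularOn γ (-1) 0 ∧ IsRegularOn γ 0 1 ∧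
    HasDerivWithinAt γ w (Icc 0 1) 0 ∧ HasDerivWithinAt γ (-(Complex.I * w)) (Icc (-1) 0) 0

/-- Two curves of `S` meet at right angles at the point `z`, where both of them have a right angle
corner: near `z` the set `S` is the union of two curves that have only `z` in common; neither is
differentiable at `z`, and the four directions in which they leave `z` are
`w, i w` (first curve) and `-w, -i w` (second curve). -/
def IsRightAngleMeeting (S : Set ℂ) (z : ℂ) : Prop :=
  ∃ (w : ℂ) (γ₁ γ₂ : ℝ → ℂ),
    IsRightAngleCorner γ₁ z w ∧ IsRightAngleCorner γ₂ z (-w) ∧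
    ¬ DifferentiableAt ℝ γ₁ 0 ∧ ¬ DifferentiableAt ℝ γ₂ 0 ∧
    γ₁ '' Icc (-1) 1 ∩ γ₂ '' Icc (-1) 1 = {z} ∧
    γ₁ '' Icc (-1) 1 ∪ γ₂ '' Icc (-1) 1 ⊆ S ∧
    γ₁ '' Icc (-1) 1 ∪ γ₂ '' Icc (-1) 1 ∈ 𝓝[S] z

/-! ### Genericity and convergence of sets on the sphere -/

/-- The property `p u v` holds for generic `u, v̄`: some nonzero complex polynomial in `2n`
variables vanishes at `(u, v̄)` whenever `p u v` fails. -/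
def ForGeneric {n : ℕ} (p : (Fin n → ℂ) → (Fin n → ℂ) → Prop) : Prop :=
  ∃ P : MvPolynomial (Fin n ⊕ Fin n) ℂ, P ≠ 0 ∧
    ∀ u v : Fin n → ℂ, ¬ p u v → MvPolynomial.eval (Sum.elim u (star v)) P = 0

/-- `S t → K` as `t → ∞`, for subsets of the Riemann sphere `ℂ ∪ {∞}`, in the Vietoris topology;
on closed subsets of this compact metrizable space it is the topology of the Hausdorff metric. -/
def TendstoOnSphere (S : ℝ → Set (OnePoint ℂ)) (K : Set (OnePoint ℂ)) : Prop :=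
  Tendsto S atTop (@nhds _ (TopologicalSpace.vietoris (OnePoint ℂ)) K)

end RankOne

end

noncomputable section

namespace RankOne

open Polynomial Matrix

/-! ### The transfer function as a quotient of polynomials -/

/-! Write `p` for the characteristic polynomial of `A` and `q = v^* adj(λ - A) u`. The matrix
determinant lemma gives `charpoly (A + τ u v^*) = p - τ q` (`charpoly_perturb`), with `deg q < deg
p` and `Q = q / p`. Hence `σ(A,u,v;t)` is the set `|p| = t |q|`, and cancelling the common factor of
`p` and `q` splits it into `L_t` and the zeros of that factor, which are the frozen eigenvalues. The
global statements concern sets `|p| = t |q|` with `deg q < deg p`. Decay of `q / p` at infinity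
gives compactness and upper semicontinuity in `t`; the open mapping theorem gives lower
semicontinuity.

Locally, if `Q - Q(z)` vanishes at `z` to order `k`, then `Q = Q(z) exp(h ^ k)` for a local
coordinate `h` (`localModel_of_analyticAt`). So `|Q| = |Q(z)|` becomes `Re h ^ k = 0`, which is `k`
lines through the origin, and `k = 1` exactly off the critical points. If the level is regular, `Q`
maps the compact set `L_t` to a circle by a local homeomorphism, hence a covering. Lifting the
rotation of the circle gives a flow on `L_t` whose orbits are the closed curves
(`exists_smoothClosedCurves`).

For generic vectors, `q` and the numerator `q' p - q p'` of `Q'` are bilinear forms `v^* M u` with a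
matrix `M` over `ℂ[X]` such that `N M` is `p` or `p ^ 2` times the identity for some `N`. If the
form in indeterminate `u, v̄` had a repeated factor, differentiating in the entries of `v̄` would
make this factor divide `M u`, hence `N M u`, hence a power of `p`. So multiple zeros occur only at
zeros of `p` (`map_mem_radical`, `exists_generic_no_double_zero`). Generically such zeros are poles
of `Q` (`exists_generic_pole`), so the critical points are simple zeros of `Q'` with `Q ≠ 0`. There
`k = 2`, and the four half-lines regroup into two right-angle corners. -/

/-- The numerator `v^* adj(λ - A) u` of the transfer function over the characteristic polynomial. -/
def transferNum {n : ℕ} (A : Matrix (Fin n) (Fin n) ℂ) (u v : Fin n → ℂ) : ℂ[X] :=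
  (fun i => C (star (v i))) ⬝ᵥ (A.charmatrix.adjugate *ᵥ fun i => C (u i))

theorem det_add_vecMulVec_of_field {m K : Type*} [Fintype m] [DecidableEq m] [Field K]
    {M : Matrix m m K} (hM : M.det ≠ 0) (x y : m → K) :
    (M + vecMulVec x y).det = M.det + y ⬝ᵥ (M.adjugate *ᵥ x) := by
  have hu : IsUnit M.det := isUnit_iff_ne_zero.2 hM
  have h1 : (1 + replicateRow Unit y * M⁻¹ * replicateCol Unit x).det =
      1 + (M.det)⁻¹ * (y ⬝ᵥ (M.adjugate *ᵥ x)) := by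
    rw [det_unique, Matrix.add_apply, Matrix.one_apply_eq, Matrix.mul_assoc, ← replicateCol_mulVec,
      replicateRow_mul_replicateCol_apply, inv_def, Ring.inverse_eq_inv', smul_mulVec,
      dotProduct_smul, smul_eq_mul]
  rw [vecMulVec_eq Unit, det_add_replicateCol_mul_replicateRow hu, h1]
  field_simp

/-- The characteristic matrix is not invertible over `ℂ[X]`, so the identity is proved in the
fraction field and pulled back by injectivity. -/
theorem det_add_vecMulVec_of_isDomain {m R : Type*} [Fintype m] [DecidableEq m] [CommRing R]
    [IsDomain R] {M : Matrix m m R} (hM : M.det ≠ 0) (x y : m → R) :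
    (M + vecMulVec x y).det = M.det + y ⬝ᵥ (M.adjugate *ᵥ x) := by
  set φ := algebraMap R (FractionRing R) with hφ
  apply IsFractionRing.injective R (FractionRing R)
  have h := det_add_vecMulVec_of_field (M := φ.mapMatrix M) (by
    rw [← RingHom.map_det]
    simpa [hφ] using hM) (φ ∘ x) (φ ∘ y)
  have h2 : φ.mapMatrix (vecMulVec x y) = vecMulVec (φ ∘ x) (φ ∘ y) := by
    ext1 i j
    simp [vecMulVec]
  have h3 : φ.mapMatrix M.adjugate *ᵥ (φ ∘ x) = φ ∘ (M.adjugate *ᵥ x) := by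
    ext1 i
    simp [RingHom.map_mulVec]
  rw [← hφ, RingHom.map_det, map_add, map_add, RingHom.map_det, RingHom.map_dotProduct, h2, h,
    ← RingHom.map_adjugate, h3]

section

variable {n : ℕ} (A : Matrix (Fin n) (Fin n) ℂ) (u v : Fin n → ℂ)

theorem charpoly_perturb (τ : ℂ) :
    (perturb A u v τ).charpoly = A.charpoly - C τ * transferNum A u v := by
  have h : (perturb A u v τ).charmatrix =
      A.charmatrix + vecMulVec (fun i => C (u i)) (fun i => -(C τ * C (star (v i)))) := by
    ext1 i j
    simp only [charmatrix_apply, perturb, Matrix.add_apply, Matrix.smul_apply, vecMulVec_apply, Pi.star_apply,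
      smul_eq_mul, map_add, map_mul]
    ring
  rw [charpoly, h, det_add_vecMulVec_of_isDomain]
  · simp only [transferNum, dotProduct, charpoly, neg_mul, Finset.sum_neg_distrib, mul_assoc,
      ← Finset.mul_sum, sub_eq_add_neg]
  · exact A.charpoly_monic.ne_zero

/-- At `τ = 1` the numerator is a difference of two monic polynomials of the same degree. -/
theorem degree_transferNum_lt : (transferNum A u v).degree < A.charpoly.degree := by
  have h := charpoly_perturb A u v 1
  have h' : transferNum A u v = A.charpoly - (perturb A u v 1).charpoly := by rw [h]; simp
  rw [h']
  refine degree_sub_lt_left ?_ A.charpoly_monic.ne_zero ?_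
  · rw [charpoly_degree_eq_dim, charpoly_degree_eq_dim]
  · rw [A.charpoly_monic.leadingCoeff, (charpoly_monic _).leadingCoeff]

theorem Q_eq : Q A u v =
    algebraMap ℂ[X] (RatFunc ℂ) (transferNum A u v) / algebraMap ℂ[X] (RatFunc ℂ) A.charpoly := by
  have h : (RatFunc.X : RatFunc ℂ) • (1 : Matrix (Fin n) (Fin n) (RatFunc ℂ))
        - A.map (RatFunc.C : ℂ →+* RatFunc ℂ) =
      (algebraMap ℂ[X] (RatFunc ℂ)).mapMatrix A.charmatrix := by
    ext1 i j
    by_cases hij : i = j <;> simp [hij]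
  rw [Q, h, inv_def, ← RingHom.map_det, ← RingHom.map_adjugate, Ring.inverse_eq_inv', smul_mulVec,
    dotProduct_smul, smul_eq_mul, div_eq_inv_mul, charpoly, transferNum]
  congr 1
  simp [dotProduct, mulVec]


/-! ### The reduced fraction -/

/-- The polynomial by which the fraction `transferNum / charpoly` has to be reduced. -/
theorem exists_common_factor : ∃ g : ℂ[X], g ≠ 0 ∧ A.charpoly = (Q A u v).denom * g ∧
    transferNum A u v = (Q A u v).num * g := by
  have hp : algebraMap ℂ[X] (RatFunc ℂ) A.charpoly ≠ 0 := by
    simpa using A.charpoly_monic.ne_zero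
  have hd : algebraMap ℂ[X] (RatFunc ℂ) (Q A u v).denom ≠ 0 := by
    simpa using RatFunc.denom_ne_zero _
  have h1 := (RatFunc.num_div_denom (Q A u v)).trans (Q_eq A u v)
  rw [div_eq_div_iff hd hp, ← map_mul, ← map_mul] at h1
  have h2 : (Q A u v).num * A.charpoly = transferNum A u v * (Q A u v).denom :=
    RatFunc.algebraMap_injective ℂ h1
  obtain ⟨g, hg⟩ : (Q A u v).denom ∣ A.charpoly :=
    (RatFunc.isCoprime_num_denom _).symm.dvd_of_dvd_mul_left ⟨_, h2.trans (mul_comm _ _)⟩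
  refine ⟨g, ?_, hg, ?_⟩
  · rintro rfl
    exact A.charpoly_monic.ne_zero (by simpa using hg)
  · apply mul_right_cancel₀ (RatFunc.denom_ne_zero (Q A u v))
    rw [← h2, hg]
    ring

theorem degree_num_lt : (Q A u v).num.degree < (Q A u v).denom.degree := by
  obtain ⟨g, hg, h1, h2⟩ := exists_common_factor A u v
  have h := degree_transferNum_lt A u v
  rw [h1, h2, degree_mul, degree_mul] at h
  exact lt_of_add_lt_add_right h

theorem Qval_eq_div (z : ℂ) : Qval A u v z = (Q A u v).num.eval z / (Q A u v).denom.eval z := rfl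

/-- The set `{|p| = t |q|}`. -/
def levelSet (p q : ℂ[X]) (t : ℝ) : Set ℂ := {z | ‖p.eval z‖ = t * ‖q.eval z‖}

theorem not_num_denom_zero (z : ℂ) :
    ¬ ((Q A u v).num.eval z = 0 ∧ (Q A u v).denom.eval z = 0) := by
  rintro ⟨h1, h2⟩
  obtain ⟨a, b, hab⟩ := RatFunc.isCoprime_num_denom (Q A u v)
  simpa [h1, h2] using congrArg (eval z) hab

/-- The product form needs no separate regularity condition: numerator and denominator are coprime,
so for `t > 0` neither a pole nor a zero of `Q` satisfies it. -/
theorem level_eq {t : ℝ} (ht : 0 < t) :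
    level A u v t = levelSet (Q A u v).denom (Q A u v).num t := by
  ext z
  have hz := not_num_denom_zero A u v z
  simp only [level, Regular, Qval_eq_div, levelSet, mem_ofPred_eq, norm_div, one_div_div]
  by_cases hn : (Q A u v).num.eval z = 0
  · simp only [hn, norm_zero, div_zero, mul_zero, norm_eq_zero]
    simp only [hn, true_and] at hz
    simp [hz, ht.ne]
  · rw [div_eq_iff (norm_ne_zero_iff.2 hn)]
    refine ⟨fun h => h.2, fun h => ⟨fun h0 => ?_, h⟩⟩
    rw [h0, norm_zero] at h
    simp [ht.ne', hn] at h

theorem mem_spectrum_perturb (τ z : ℂ) : z ∈ spectrum ℂ (perturb A u v τ) ↔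
    A.charpoly.eval z = τ * (transferNum A u v).eval z := by
  rw [Matrix.mem_spectrum_iff_isRoot_charpoly, charpoly_perturb, IsRoot, eval_sub, eval_mul, eval_C,
    sub_eq_zero]

theorem sigma_eq {t : ℝ} (ht : 0 < t) :
    sigma A u v t = levelSet A.charpoly (transferNum A u v) t := by
  ext z
  simp only [sigma, mem_iUnion, mem_spectrum_perturb, levelSet, mem_ofPred_eq, exists_prop]
  constructor
  · rintro ⟨θ, -, h⟩
    rw [h]
    simp [Complex.norm_exp_ofReal_mul_I, abs_of_pos ht]
  · intro h
    by_cases hq : (transferNum A u v).eval z = 0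
    · rw [hq] at h ⊢
      refine ⟨0, ⟨le_rfl, Real.two_pi_pos⟩, by simpa using h⟩
    · set τ := A.charpoly.eval z / (transferNum A u v).eval z with hτ
      have hn : ‖τ‖ = t := by
        rw [hτ, norm_div, h, mul_div_cancel_right₀ _ (norm_ne_zero_iff.2 hq)]
      -- `Complex.arg` lies in `(-π, π]`; it is reduced modulo `2π` to reach `[0, 2π)`.
      refine ⟨toIcoMod Real.two_pi_pos 0 τ.arg, by
        simpa using toIcoMod_mem_Ico Real.two_pi_pos 0 τ.arg, ?_⟩
      have he : Complex.exp ((toIcoMod Real.two_pi_pos 0 τ.arg : ℝ) * Complex.I) =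
          Complex.exp (τ.arg * Complex.I) := by
        rw [Complex.exp_eq_exp_iff_exists_int]
        refine ⟨-toIcoDiv Real.two_pi_pos 0 τ.arg, ?_⟩
        rw [toIcoMod]
        push_cast
        ring
      rw [he, ← hn, Complex.norm_mul_exp_arg_mul_I, hτ, div_mul_cancel₀ _ hq]

theorem frozen_eq : frozen A u v =
    {z | A.charpoly.eval z = 0 ∧ (transferNum A u v).eval z = 0} := by
  ext z
  simp only [frozen, mem_spectrum_perturb, mem_ofPred_eq]
  constructor
  · intro h
    have h0 := h 0
    have h1 := h 1
    rw [zero_mul] at h0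
    rw [h0, one_mul] at h1
    exact ⟨h0, h1.symm⟩
  · rintro ⟨h0, h1⟩ τ
    simp [h0, h1]

theorem zerosQ_eq : zerosQ A u v = {z | (Q A u v).num.eval z = 0} := by
  ext z
  have hz := not_num_denom_zero A u v z
  simp only [zerosQ, Regular, Qval_eq_div, mem_ofPred_eq, div_eq_zero_iff]
  tauto

/-- Off the zeros of the common factor `g` it cancels from both sides. Common zeros of `p` and `q`
are zeros of `g`, because the reduced pair has none. -/
theorem sigma_eq_level_union_frozen {t : ℝ} (ht : 0 < t) :
    sigma A u v t = level A u v t ∪ frozen A u v := by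
  rw [sigma_eq A u v ht, level_eq A u v ht, frozen_eq]
  obtain ⟨g, hg, h1, h2⟩ := exists_common_factor A u v
  rw [h1, h2]
  ext z
  have hz := not_num_denom_zero A u v z
  simp only [levelSet, mem_ofPred_eq, mem_union, eval_mul, norm_mul]
  by_cases hgz : g.eval z = 0
  · simp [hgz]
  · rw [← mul_assoc, mul_left_inj' (norm_ne_zero_iff.2 hgz)]
    simp only [mul_eq_zero, hgz, or_false]
    tauto

/-- This identifies the finite part of the limit of `σ(A,u,v;t)` with the zeros of the unreduced
numerator, so the limit theorem for `levelSet` applies to the unreduced pair. -/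
theorem zerosQ_union_frozen :
    zerosQ A u v ∪ frozen A u v = {z | (transferNum A u v).eval z = 0} := by
  rw [zerosQ_eq, frozen_eq]
  obtain ⟨g, hg, h1, h2⟩ := exists_common_factor A u v
  rw [h1, h2]
  ext z
  simp only [mem_ofPred_eq, mem_union, eval_mul, mul_eq_zero]
  tauto

theorem Q_eq_zero_iff : Q A u v = 0 ↔ transferNum A u v = 0 := by
  have hp : algebraMap ℂ[X] (RatFunc ℂ) A.charpoly ≠ 0 := by
    simpa using A.charpoly_monic.ne_zero
  rw [Q_eq, div_eq_zero_iff, or_iff_left hp]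
  simp

theorem spectrum_union_sigma_union_zerosQ :
    spectrum ℂ A ∪ (⋃ t ∈ Ioi (0 : ℝ), sigma A u v t) ∪ zerosQ A u v = univ := by
  refine eq_univ_of_forall fun z => ?_
  by_cases h : z ∈ zerosQ A u v ∪ frozen A u v
  · rcases h with h | h
    · exact Or.inr h
    · refine Or.inl (Or.inl ?_)
      simpa [perturb] using h 0
  · rw [zerosQ_union_frozen, mem_ofPred_eq] at h
    by_cases hp : A.charpoly.eval z = 0
    · exact Or.inl (Or.inl (Matrix.mem_spectrum_iff_isRoot_charpoly.2 hp))
    · refine Or.inl (Or.inr (mem_biUnion (x := ‖A.charpoly.eval z‖ / ‖(transferNum A u v).eval z‖)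
        (mem_Ioi.2 (by positivity)) ?_))
      rw [sigma_eq A u v (by positivity)]
      exact (div_mul_cancel₀ _ (norm_ne_zero_iff.2 h)).symm

end

end RankOne

end

noncomputable section

namespace RankOne

open Polynomial

/-! ### Level sets of quotients of polynomials -/

section LevelSet

variable {p q : ℂ[X]}

/-! ### Behaviour at infinity and compactness. -/

theorem tendsto_eval_div_pow_of_degree_lt {n : ℕ} (h : q.degree < n) :
    Tendsto (fun z : ℂ => q.eval z / z ^ n) (Bornology.cobounded ℂ) (𝓝 0) := by
  rcases eq_or_ne q 0 with rfl | hq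
  · simp
  have hd : q.natDegree < n := (natDegree_lt_iff_degree_lt hq).2 h
  have h1 : ∀ z : ℂ, q.eval z / z ^ n =
      ∑ k ∈ Finset.range n, q.coeff k * (z ^ k / z ^ n) := by
    intro z
    rw [eval_eq_sum_range' hd, Finset.sum_div]
    simp only [mul_div_assoc]
  simp only [h1]
  rw [show (0 : ℂ) = ∑ k ∈ Finset.range n, q.coeff k * 0 by simp]
  refine tendsto_finsetSum _ fun k hk => Tendsto.const_mul _ ?_
  have hk' : k < n := Finset.mem_range.1 hk
  have h2 : Tendsto (fun z : ℂ => (z⁻¹) ^ (n - k)) (Bornology.cobounded ℂ) (𝓝 0) := by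
    have := (tendsto_inv₀_cobounded (α := ℂ)).pow (n - k)
    rwa [zero_pow (by omega)] at this
  refine h2.congr' ?_
  filter_upwards [Bornology.eventually_ne_cobounded (0 : ℂ)] with z hz
  rw [inv_pow, eq_div_iff (pow_ne_zero _ hz), inv_mul_eq_div, div_eq_iff (pow_ne_zero _ hz),
    ← pow_add, Nat.add_sub_cancel' hk'.le]

theorem tendsto_eval_div_eval_of_degree_lt (h : q.degree < p.degree) :
    Tendsto (fun z : ℂ => q.eval z / p.eval z) (Bornology.cobounded ℂ) (𝓝 0) := by
  have hp : p ≠ 0 := by rintro rfl; simp at h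
  set n := p.natDegree with hn
  have hpn : p.degree = n := degree_eq_natDegree hp
  have h1 : Tendsto (fun z : ℂ => p.eval z / z ^ n) (Bornology.cobounded ℂ)
      (𝓝 (p.leadingCoeff + 0)) := by
    have he : p.eraseLead.degree < n := hpn ▸ degree_eraseLead_lt hp
    refine ((tendsto_eval_div_pow_of_degree_lt he).const_add p.leadingCoeff).congr' ?_
    filter_upwards [Bornology.eventually_ne_cobounded (0 : ℂ)] with z hz
    conv_rhs => rw [← p.eraseLead_add_C_mul_X_pow]
    rw [eval_add, eval_mul, eval_C, eval_pow, eval_X, add_div, mul_div_assoc, ← hn,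
      div_self (pow_ne_zero _ hz)]
    ring
  have h2 := (tendsto_eval_div_pow_of_degree_lt (hpn ▸ h)).div h1
    (by simpa using hp)
  rw [zero_div] at h2
  refine h2.congr' ?_
  filter_upwards [Bornology.eventually_ne_cobounded (0 : ℂ)] with z hz
  rw [Pi.div_apply, div_div_div_cancel_right₀ (pow_ne_zero _ hz)]

theorem eventually_cobounded_eval_ne_zero (hp : p ≠ 0) :
    ∀ᶠ z in Bornology.cobounded ℂ, p.eval z ≠ 0 := by
  have h := (p.rootSet_finite ℂ).isBounded
  rw [← Bornology.isCobounded_compl_iff] at h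
  filter_upwards [h] with z hz h0
  exact hz (by simp [mem_rootSet, hp, h0])

theorem eventually_cobounded_mul_norm_lt (h : q.degree < p.degree) (t : ℝ) :
    ∀ᶠ z in Bornology.cobounded ℂ, t * ‖q.eval z‖ < ‖p.eval z‖ := by
  have hp : p ≠ 0 := by rintro rfl; simp at h
  have h1 := (tendsto_eval_div_eval_of_degree_lt h).norm
  rw [norm_zero] at h1
  have h2 := (h1.const_mul t).eventually_lt_const (u := 1) (by simp)
  filter_upwards [h2, eventually_cobounded_eval_ne_zero hp] with z hz h3
  rwa [norm_div, ← mul_div_assoc, div_lt_one (norm_pos_iff.2 h3)] at hz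

theorem isClosed_levelSet (p q : ℂ[X]) (t : ℝ) : IsClosed (levelSet p q t) :=
  isClosed_eq (by fun_prop) (by fun_prop)

theorem isCompact_levelSet (h : q.degree < p.degree) (t : ℝ) : IsCompact (levelSet p q t) := by
  refine Metric.isCompact_of_isClosed_isBounded (isClosed_levelSet p q t) ?_
  rw [← Bornology.isCobounded_compl_iff]
  filter_upwards [eventually_cobounded_mul_norm_lt h t] with z hz
  exact fun h0 => hz.ne' h0

/-! ### Nonconstancy and openness of the quotient. -/

theorem not_eventually_eval_eq (h : q.degree < p.degree) (hq : q ≠ 0) (c z : ℂ) :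
    ¬ ∀ᶠ w in 𝓝 z, q.eval w = c * p.eval w := by
  intro h1
  have h2 : q - C c * p = 0 := by
    refine eq_zero_of_infinite_isRoot _ ((infinite_of_mem_nhds z h1).mono fun w hw => ?_)
    simpa [sub_eq_zero] using hw
  rw [sub_eq_zero] at h2
  rcases eq_or_ne c 0 with rfl | hc
  · exact hq (by simpa using h2)
  · rw [h2, degree_C_mul hc] at h
    exact lt_irrefl _ h

theorem not_eventually_div_eq (h : q.degree < p.degree) (hq : q ≠ 0) {z : ℂ}
    (hz : p.eval z ≠ 0) (c : ℂ) :
    ¬ ∀ᶠ w in 𝓝 z, q.eval w / p.eval w = c := by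
  intro h1
  refine not_eventually_eval_eq h hq c z ?_
  filter_upwards [h1, p.continuous.continuousAt.eventually_ne hz] with w hw hp
  rwa [div_eq_iff hp] at hw

theorem analyticAt_eval_div (p q : ℂ[X]) {z : ℂ} (hz : p.eval z ≠ 0) :
    AnalyticAt ℂ (fun w => q.eval w / p.eval w) z :=
  (AnalyticOnNhd.eval_polynomial q z trivial).div (AnalyticOnNhd.eval_polynomial p z trivial) hz

/-- Open mapping theorem; the locally constant alternative is excluded by the degrees. -/
theorem eventually_exists_div_eq (h : q.degree < p.degree) (hq : q ≠ 0) {z : ℂ}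
    (hz : p.eval z ≠ 0) {V : Set ℂ} (hV : V ∈ 𝓝 z) :
    ∀ᶠ y in 𝓝 (q.eval z / p.eval z), ∃ w ∈ V, p.eval w ≠ 0 ∧ q.eval w / p.eval w = y := by
  rcases (analyticAt_eval_div p q hz).eventually_constant_or_nhds_le_map_nhds with h1 | h1
  · exact absurd h1 (not_eventually_div_eq h hq hz _)
  · have h2 : V ∩ {w | p.eval w ≠ 0} ∈ 𝓝 z :=
      inter_mem hV (p.continuous.continuousAt.eventually_ne hz)
    filter_upwards [h1 (image_mem_map h2)] with y hy
    obtain ⟨w, ⟨hw, hw'⟩, rfl⟩ := hy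
    exact ⟨w, hw, hw', rfl⟩

/-! ### Dependence of the level sets on `t`. -/

theorem mem_levelSet_iff_div {t : ℝ} (ht : 0 < t) {z : ℂ} (hz : p.eval z ≠ 0) :
    z ∈ levelSet p q t ↔ ‖q.eval z / p.eval z‖ = t⁻¹ := by
  have := norm_ne_zero_iff.2 hz
  rw [levelSet, mem_ofPred_eq, norm_div, div_eq_iff this, inv_mul_eq_div, eq_div_iff ht.ne',
    mul_comm, eq_comm]

/-- Lower half of Vietoris continuity. A point where `p` vanishes is a common zero of `p` and `q`
and lies on every level set; any other point can be moved by openness of `q / p`. -/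
theorem eventually_levelSet_inter_nonempty (h : q.degree < p.degree) {t : ℝ} (ht : 0 < t)
    {V : Set ℂ} (hV : IsOpen V) (hne : (levelSet p q t ∩ V).Nonempty) :
    ∀ᶠ s in 𝓝 t, (levelSet p q s ∩ V).Nonempty := by
  obtain ⟨z, hz, hzV⟩ := hne
  by_cases hp : p.eval z = 0
  · have hq : q.eval z = 0 := by
      rw [levelSet, mem_ofPred_eq, hp, norm_zero] at hz
      simpa [ht.ne'] using hz.symm
    exact .of_forall fun s => ⟨z, by simp [levelSet, hp, hq], hzV⟩
  · have hq : q ≠ 0 := by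
      rintro rfl
      rw [mem_levelSet_iff_div ht hp] at hz
      simp [ht.ne] at hz
    -- The value is rescaled by `t / s`, which changes its modulus from `1 / t` to `1 / s`.
    have h1 : Tendsto (fun s : ℝ => q.eval z / p.eval z * ((t / s : ℝ) : ℂ)) (𝓝 t)
        (𝓝 (q.eval z / p.eval z)) := by
      have h2 : ContinuousAt (fun s : ℝ => q.eval z / p.eval z * ((t / s : ℝ) : ℂ)) t := by
        have := ht.ne'
        fun_prop (disch := assumption)
      simpa [ContinuousAt, div_self ht.ne'] using h2
    filter_upwards [h1.eventually (eventually_exists_div_eq h hq hp (hV.mem_nhds hzV)),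
      eventually_gt_nhds ht] with s hs hs0
    obtain ⟨w, hw, hw', hw''⟩ := hs
    refine ⟨w, ?_, hw⟩
    rw [mem_levelSet_iff_div ht hp] at hz
    rw [mem_levelSet_iff_div hs0 hw', hw'', norm_mul, hz, Complex.norm_real, Real.norm_eq_abs,
      abs_of_pos (by positivity)]
    field_simp

theorem eventually_levelSet_subset (h : q.degree < p.degree) {t : ℝ}
    {V : Set ℂ} (hV : IsOpen V) (hsub : levelSet p q t ⊆ V) :
    ∀ᶠ s in 𝓝 t, levelSet p q s ⊆ V := by
  -- One radius serves all `s < t + 1`, since `s |q| ≤ (t + 1) |q| < |p|` outside the ball. Inside,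
  -- a compactness argument works on the part of the ball off `V`.
  obtain ⟨r, -, hr⟩ := (hasBasis_cobounded_norm (E := ℂ)).eventually_iff.1
    (eventually_cobounded_mul_norm_lt h (t + 1))
  have hK : IsCompact (Metric.closedBall (0 : ℂ) r \ V) :=
    (isCompact_closedBall 0 r).diff hV
  have h1 := hK.eventually_forall_of_forall_eventually (x₀ := t)
    (P := fun s z => ‖p.eval z‖ ≠ s * ‖q.eval z‖) (fun z hz => by
      have hne : ‖p.eval z‖ ≠ t * ‖q.eval z‖ := fun h0 => hz.2 (hsub h0)
      have hc : ContinuousAt (fun x : ℝ × ℂ => ‖p.eval x.2‖ - x.1 * ‖q.eval x.2‖) (t, z) := by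
        fun_prop
      filter_upwards [hc.eventually_ne (sub_ne_zero.2 hne)] with x hx
      exact sub_ne_zero.1 hx)
  filter_upwards [h1, eventually_lt_nhds (lt_add_one t)] with s hs hst z hz
  by_contra hzV
  by_cases hzr : ‖z‖ ≤ r
  · exact hs z ⟨by simpa using hzr, hzV⟩ hz
  · have h2 : (t + 1) * ‖q.eval z‖ < ‖p.eval z‖ := hr (not_le.1 hzr).le
    have h3 : ‖p.eval z‖ = s * ‖q.eval z‖ := hz
    rw [h3] at h2
    exact absurd (mul_le_mul_of_nonneg_right hst.le (norm_nonneg (q.eval z))) (not_le.2 h2)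

/-- The two semicontinuity lemmas give convergence in the Vietoris topology. At a compact set its
neighbourhoods are those of the Hausdorff uniformity. -/
theorem tendsto_hausdorffEDist_levelSet (h : q.degree < p.degree) {t : ℝ} (ht : 0 < t) :
    Tendsto (fun s => Metric.hausdorffEDist (levelSet p q s) (levelSet p q t)) (𝓝 t) (𝓝 0) := by
  have h1 : Tendsto (levelSet p q) (𝓝 t)
      (@nhds _ (TopologicalSpace.vietoris ℂ) (levelSet p q t)) := by
    rw [TopologicalSpace.tendsto_nhds_generateFrom_iff]
    rintro _ (⟨V, hV, rfl⟩ | ⟨V, hV, rfl⟩) hm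
    · exact eventually_levelSet_subset h hV hm
    · exact eventually_levelSet_inter_nonempty h ht hV hm
  let := UniformSpace.hausdorff ℂ
  rw [← (isCompact_levelSet h t).nhds_hausdorff_eq_nhds_vietoris] at h1
  rw [ENNReal.tendsto_nhds_zero]
  intro ε hε
  have h2 : hausdorffEntourage {x : ℂ × ℂ | edist x.1 x.2 ≤ ε} ∈ uniformity (Set ℂ) :=
    Filter.mem_lift' (mem_uniformity_edist.2 ⟨ε, hε, fun h => h.le⟩)
  filter_upwards [Uniform.tendsto_nhds_left.1 h1 h2] with s hs
  exact Metric.hausdorffEDist_le_of_mem_hausdorffEntourage hs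

/-- Off an open set containing `∞` and the zeros of `q`, the quotient `p / q` is bounded on a
compact set, so large levels avoid it. Conversely, a zero of `q` is approached by solving `q / p = 1
/ t` nearby, and `∞` is approached along the positive real axis. -/
theorem tendstoOnSphere_levelSet (h : q.degree < p.degree) (hq : q ≠ 0) :
    TendstoOnSphere (fun t => (↑) '' levelSet p q t)
      ((↑) '' {z | q.eval z = 0} ∪ {OnePoint.infty}) := by
  rw [TendstoOnSphere, TopologicalSpace.tendsto_nhds_generateFrom_iff]
  rintro _ (⟨V, hV, rfl⟩ | ⟨V, hV, rfl⟩) hm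
  · have hm' : ((↑) '' {z : ℂ | q.eval z = 0} ∪ {OnePoint.infty} : Set (OnePoint ℂ)) ⊆ V := hm
    have hK := ((OnePoint.isOpen_iff_of_mem (hm' (Or.inr rfl))).1 hV).2
    have hne : ∀ z ∈ (((↑) : ℂ → OnePoint ℂ) ⁻¹' V)ᶜ, q.eval z ≠ 0 := fun z hz h0 =>
      hz (hm' (Or.inl ⟨z, h0, rfl⟩))
    obtain ⟨M, hM⟩ := hK.exists_bound_of_continuousOn (f := fun z => p.eval z / q.eval z)
      (p.continuous.continuousOn.div q.continuous.continuousOn hne)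
    filter_upwards [eventually_gt_atTop M] with t ht
    rintro _ ⟨z, hz, rfl⟩
    by_contra hzV
    have h1 := hM z hzV
    rw [norm_div, show ‖p.eval z‖ = t * ‖q.eval z‖ from hz,
      mul_div_cancel_right₀ _ (norm_ne_zero_iff.2 (hne z hzV))] at h1
    exact absurd ht (not_lt.2 h1)
  · obtain ⟨x, hx | hx, hxV⟩ := hm
    · obtain ⟨z, hz, rfl⟩ := hx
      rw [mem_ofPred_eq] at hz
      by_cases hp : p.eval z = 0
      · exact Eventually.of_forall fun t => ⟨z, ⟨z, by simp [levelSet, hp, hz], rfl⟩, hxV⟩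
      have h1 := eventually_exists_div_eq h hq hp
        ((hV.preimage OnePoint.continuous_coe).mem_nhds hxV)
      rw [hz, zero_div] at h1
      have h2 : Tendsto (fun t : ℝ => ((t⁻¹ : ℝ) : ℂ)) atTop (𝓝 0) := by
        exact (Complex.continuous_ofReal.tendsto' 0 0 Complex.ofReal_zero).comp tendsto_inv_atTop_zero
      filter_upwards [h2.eventually h1, eventually_gt_atTop 0] with t ht ht0
      obtain ⟨w, hw, hw', hw''⟩ := ht
      refine ⟨w, ⟨w, ?_, rfl⟩, hw⟩
      rw [mem_levelSet_iff_div ht0 hw', hw'', Complex.norm_real, Real.norm_eq_abs,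
        abs_of_pos (by positivity)]
    · rw [mem_singleton_iff] at hx
      subst hx
      have hp0 : p ≠ 0 := by rintro rfl; simp at h
      have hb := ((OnePoint.isOpen_iff_of_mem hxV).1 hV).2.isBounded
      rw [← Bornology.isCobounded_compl_iff, compl_compl] at hb
      have h1 : ∀ᶠ z : ℂ in Bornology.cobounded ℂ, (z : OnePoint ℂ) ∈ V ∧ p.eval z ≠ 0 ∧
          q.eval z ≠ 0 := by
        filter_upwards [hb, eventually_cobounded_eval_ne_zero hp0,
          eventually_cobounded_eval_ne_zero hq] with z h1 h2 h3
        exact ⟨h1, h2, h3⟩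
      have hc : Tendsto ((↑) : ℝ → ℂ) atTop (Bornology.cobounded ℂ) := by
        rw [← tendsto_norm_atTop_iff_cobounded]
        simpa using tendsto_abs_atTop_atTop
      obtain ⟨r, hr⟩ := eventually_atTop.1 (hc.eventually h1)
      set f : ℝ → ℝ := fun x => ‖q.eval (x : ℂ) / p.eval (x : ℂ)‖ with hf
      have hfc : ContinuousOn f (Ici r) := by
        refine (ContinuousOn.div ?_ ?_ fun x hx => (hr x hx).2.1).norm <;> fun_prop
      have hf0 : Tendsto f atTop (𝓝 0) := by
        simpa [hf] using ((tendsto_eval_div_eval_of_degree_lt h).comp hc).norm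
      -- On a far real ray `|q / p|` is continuous, starts positive and tends to `0`, so it takes
      -- every sufficiently small positive value `1 / t`.
      have himg := isPreconnected_Ici.intermediate_value_Ioc (self_mem_Ici (a := r))
        (le_principal_iff.2 (Ici_mem_atTop r)) hfc hf0
      have hfr : 0 < f r := norm_pos_iff.2 (div_ne_zero (hr r le_rfl).2.2 (hr r le_rfl).2.1)
      filter_upwards [tendsto_inv_atTop_zero.eventually_lt_const hfr, eventually_gt_atTop 0]
        with t ht ht0
      obtain ⟨x, hx, hxt⟩ := himg ⟨inv_pos.2 ht0, ht.le⟩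
      exact ⟨(x : ℂ), ⟨x, (mem_levelSet_iff_div ht0 (hr x hx).2.1).2 hxt, rfl⟩, (hr x hx).1⟩

/-! ### Level sets as real algebraic curves. -/

theorem exists_mvPolynomial_eval (p : ℂ[X]) : ∃ a b : MvPolynomial (Fin 2) ℝ, ∀ z : ℂ,
    p.eval z = ⟨MvPolynomial.eval ![z.re, z.im] a, MvPolynomial.eval ![z.re, z.im] b⟩ := by
  induction p using Polynomial.induction_on' with
  | add p q hp hq =>
    obtain ⟨a, b, h⟩ := hp
    obtain ⟨c, d, h'⟩ := hq
    exact ⟨a + c, b + d, fun z => by rw [eval_add, h, h']; simp [Complex.ext_iff]⟩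
  | monomial n c =>
    induction n with
    | zero => exact ⟨.C c.re, .C c.im, fun z => by simp⟩
    | succ n ih =>
      obtain ⟨a, b, h⟩ := ih
      refine ⟨a * .X 0 - b * .X 1, a * .X 1 + b * .X 0, fun z => ?_⟩
      rw [← monomial_mul_X, eval_mul, eval_X, h]
      simp [Complex.ext_iff]

/-- The polynomial is `|p|² - t² |q|²`; it is nonzero because it is positive far out. -/
theorem isAlgebraicCurve_levelSet (h : q.degree < p.degree) {t : ℝ} (ht : 0 < t) :
    IsAlgebraicCurve (levelSet p q t) := by
  obtain ⟨a, b, hp⟩ := exists_mvPolynomial_eval p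
  obtain ⟨c, d, hq⟩ := exists_mvPolynomial_eval q
  have key : ∀ z, MvPolynomial.eval ![z.re, z.im]
      (a ^ 2 + b ^ 2 - MvPolynomial.C (t ^ 2) * (c ^ 2 + d ^ 2)) =
      ‖p.eval z‖ ^ 2 - (t * ‖q.eval z‖) ^ 2 := by
    intro z
    rw [mul_pow, Complex.sq_norm, Complex.sq_norm, hp, hq]
    simp [Complex.normSq_apply, sq]
  refine ⟨a ^ 2 + b ^ 2 - MvPolynomial.C (t ^ 2) * (c ^ 2 + d ^ 2), fun h0 => ?_, ?_⟩
  · obtain ⟨z, hz⟩ := (eventually_cobounded_mul_norm_lt h t).exists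
    have h1 := key z
    rw [h0, map_zero, eq_comm, sub_eq_zero, pow_left_inj₀ (by positivity) (by positivity) two_ne_zero]
      at h1
    exact hz.ne' h1
  · ext z
    rw [mem_ofPred_eq, key, sub_eq_zero, pow_left_inj₀ (by positivity) (by positivity) two_ne_zero]
    rfl

end LevelSet

end RankOne

end

noncomputable section

namespace RankOne

/-! ### Local structure of level sets of holomorphic functions -/

/-- Near `z`, the set `S` is the image of `{w | Re w ^ k = 0}` under a holomorphic chart. -/
def LocalModel (S : Set ℂ) (z : ℂ) (k : ℕ) : Prop :=
  ∃ (ψ : ℂ → ℂ) (r : ℝ), 0 < r ∧ ψ 0 = z ∧ InjOn ψ (Metric.ball 0 r) ∧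
    (∀ w ∈ Metric.ball (0 : ℂ) r, AnalyticAt ℂ ψ w ∧ deriv ψ w ≠ 0) ∧
    (∀ r' > 0, ψ '' Metric.ball 0 r' ∈ 𝓝 z) ∧
    ∀ w ∈ Metric.ball (0 : ℂ) r, (ψ w ∈ S ↔ (w ^ k).re = 0)

/-- `L` is the principal logarithm of `f / f z`, which is near `1`. Since `L' = f' / f`, the
derivatives of `L` and `f` vanish to the same order, and adding one gives the orders of `L` and `f -
f z`. -/
theorem exists_analyticAt_log {f : ℂ → ℂ} {z : ℂ} (hf : AnalyticAt ℂ f z) (h0 : f z ≠ 0) :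
    ∃ L : ℂ → ℂ, AnalyticAt ℂ L z ∧ (∀ᶠ w in 𝓝 z, f w = f z * Complex.exp (L w)) ∧
      analyticOrderAt L z = analyticOrderAt (f · - f z) z := by
  have h1 : f z / f z ∈ Complex.slitPlane := by simp [div_self h0]
  have hd : AnalyticAt ℂ (fun w => f w / f z) z := hf.div analyticAt_const h0
  have hL : AnalyticAt ℂ (fun w => Complex.log (f w / f z)) z := hd.clog h1
  refine ⟨fun w => Complex.log (f w / f z), hL, ?_, ?_⟩
  · filter_upwards [hf.continuousAt.eventually_ne h0] with w hw
    rw [Complex.exp_log (div_ne_zero hw h0), mul_div_cancel₀ _ h0]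
  · rw [← hf.analyticOrderAt_deriv_add_one]
    have h2 := hL.analyticOrderAt_deriv_add_one
    simp only [div_self h0, Complex.log_one, sub_zero] at h2
    rw [← h2]
    congr 1
    have h3 : deriv (fun w => Complex.log (f w / f z)) =ᶠ[𝓝 z] fun w => deriv f w * (f w)⁻¹ := by
      filter_upwards [hf.eventually_analyticAt, hf.continuousAt.eventually_ne h0,
        hd.continuousAt.eventually (Complex.isOpen_slitPlane.mem_nhds h1)] with w hw hw0 hws
      rw [(((hw.differentiableAt.hasDerivAt).div_const (f z)).clog hws).deriv]
      field_simp
    rw [analyticOrderAt_congr h3]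
    have h4 : AnalyticAt ℂ (fun w => (f w)⁻¹) z := hf.inv h0
    have h5 : analyticOrderAt (fun w => (f w)⁻¹) z = 0 :=
      h4.analyticOrderAt_eq_zero.2 (inv_ne_zero h0)
    have h6 := analyticOrderAt_mul hf.deriv h4
    rw [h5, add_zero] at h6
    exact h6

/-- Factor `L = (w - z) ^ k g` with `g z ≠ 0`. A `k`-th root of `g` is `c (g / g z) ^ (1 / k)` with
`c ^ k = g z`: the base is near `1`, where the principal power is analytic. -/
theorem exists_analyticAt_pow_eq {L : ℂ → ℂ} {z : ℂ} {k : ℕ} (hL : AnalyticAt ℂ L z)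
    (hk : k ≠ 0) (ho : analyticOrderAt L z = k) :
    ∃ h : ℂ → ℂ, AnalyticAt ℂ h z ∧ h z = 0 ∧ deriv h z ≠ 0 ∧ ∀ᶠ w in 𝓝 z, L w = h w ^ k := by
  obtain ⟨g, hg, hg0, hLg⟩ := hL.analyticOrderAt_eq_natCast.1 ho
  obtain ⟨c, hc⟩ := IsAlgClosed.exists_pow_nat_eq (g z) (Nat.pos_of_ne_zero hk)
  have hc0 : c ≠ 0 := by
    rintro rfl
    rw [zero_pow hk] at hc
    exact hg0 hc.symm
  set H : ℂ → ℂ := fun w => c * (g w / g z) ^ ((k : ℂ)⁻¹) with hH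
  have hHa : AnalyticAt ℂ H z :=
    analyticAt_const.mul ((hg.div analyticAt_const hg0).cpow analyticAt_const
      (by simp [div_self hg0]))
  refine ⟨fun w => (w - z) * H w, (analyticAt_id.sub analyticAt_const).mul hHa, by simp, ?_, ?_⟩
  · have h1 : HasDerivAt (fun w => (w - z) * H w) (1 * H z + (z - z) * deriv H z) z :=
      ((hasDerivAt_id z).sub_const z).mul hHa.differentiableAt.hasDerivAt
    rw [h1.deriv]
    simp [hH, div_self hg0, hc0]
  · filter_upwards [hLg] with w hw
    rw [hw, hH, mul_pow, mul_pow, Complex.cpow_nat_inv_pow _ hk, hc, mul_div_cancel₀ _ hg0,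
      smul_eq_mul]

/-- With `f = f z * exp (h ^ k)`, equality of the moduli means `Re h ^ k = 0`; the chart is the
local inverse of `h`. -/
theorem localModel_of_analyticAt {f : ℂ → ℂ} {S : Set ℂ} {z : ℂ} {k : ℕ}
    (hf : AnalyticAt ℂ f z) (h0 : f z ≠ 0) (hk : k ≠ 0)
    (ho : analyticOrderAt (f · - f z) z = k)
    (hS : ∀ᶠ w in 𝓝 z, w ∈ S ↔ ‖f w‖ = ‖f z‖) : LocalModel S z k := by
  obtain ⟨L, hL, hfL, hLo⟩ := exists_analyticAt_log hf h0
  obtain ⟨h, hh, hz, hd, hLh⟩ := exists_analyticAt_pow_eq hL hk (hLo.trans ho)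
  have hsd : HasStrictDerivAt h (deriv h z) z := hh.hasStrictDerivAt
  set e := (hsd.hasStrictFDerivAt_equiv hd).toOpenPartialHomeomorph h with he
  have hze : z ∈ e.source := (hsd.hasStrictFDerivAt_equiv hd).mem_toOpenPartialHomeomorph_source
  have hcoe : (e : ℂ → ℂ) = h := (hsd.hasStrictFDerivAt_equiv hd).toOpenPartialHomeomorph_coe
  have h0t : (0 : ℂ) ∈ e.target := by
    rw [← hz, ← hcoe]
    exact e.map_source hze
  have hsymm : e.symm 0 = z := by
    rw [← hz, ← hcoe]
    exact e.left_inv hze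
  have hgood : ∀ᶠ w in 𝓝 z, (AnalyticAt ℂ h w ∧ deriv h w ≠ 0) ∧
      (w ∈ S ↔ (h w ^ k).re = 0) := by
    filter_upwards [hh.eventually_analyticAt, hh.deriv.continuousAt.eventually_ne hd, hS, hfL, hLh]
      with w h1 h2 h3 h4 h5
    refine ⟨⟨h1, h2⟩, h3.trans ?_⟩
    rw [h4, norm_mul, mul_eq_left₀ (norm_ne_zero_iff.2 h0), Complex.norm_exp, Real.exp_eq_one_iff,
      h5]
  have hgood' : ∀ᶠ w in 𝓝 (0 : ℂ), w ∈ e.target ∧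
      ((AnalyticAt ℂ h (e.symm w) ∧ deriv h (e.symm w) ≠ 0) ∧
      (e.symm w ∈ S ↔ (h (e.symm w) ^ k).re = 0)) := by
    refine Eventually.and (e.open_target.mem_nhds h0t) ?_
    have := e.symm.continuousAt (x := 0) h0t
    rw [ContinuousAt, hsymm] at this
    exact this.eventually hgood
  obtain ⟨r, hr, hball⟩ := Metric.eventually_nhds_iff_ball.1 hgood'
  refine ⟨e.symm, r, hr, hsymm, e.symm.injOn.mono fun w hw => (hball w hw).1, fun w hw => ?_,
    fun r' hr' => ?_, fun w hw => ?_⟩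
  · obtain ⟨h1, ⟨h2, h3⟩, -⟩ := hball w hw
    have hder : HasDerivAt e (deriv h (e.symm w)) (e.symm w) := by
      rw [hcoe]
      exact h2.differentiableAt.hasDerivAt
    refine ⟨?_, ?_⟩
    · refine (e.contDiffAt_symm_deriv (n := ω) h3 h1 hder ?_).analyticAt
      rw [hcoe]
      exact h2.contDiffAt
    · rw [(e.hasDerivAt_symm h1 h3 hder).deriv]
      exact inv_ne_zero h3
  · have := e.symm.map_nhds_eq (x := 0) h0t
    rw [hsymm] at this
    rw [← this]
    exact image_mem_map (Metric.ball_mem_nhds _ hr')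
  · obtain ⟨h1, -, h4⟩ := hball w hw
    rw [h4, ← hcoe, e.right_inv h1]

/-! ### The arcs -/

/-- The arc `s ↦ ψ (s a)`. -/
def ray (ψ : ℂ → ℂ) (a : ℂ) (s : ℝ) : ℂ := ψ (s * a)

theorem ofReal_mul_mem_ball {a : ℂ} {r s : ℝ} (ha : ‖a‖ < r) (hs : s ∈ Icc (-1 : ℝ) 1) :
    (s : ℂ) * a ∈ Metric.ball (0 : ℂ) r := by
  rw [mem_ball_zero_iff, norm_mul, Complex.norm_real, Real.norm_eq_abs]
  exact (mul_le_of_le_one_left (norm_nonneg a) (abs_le.2 hs)).trans_lt ha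

theorem hasDerivAt_ray {ψ : ℂ → ℂ} {a : ℂ} {s : ℝ} (h : AnalyticAt ℂ ψ (s * a)) :
    HasDerivAt (ray ψ a) (deriv ψ (s * a) * a) s := by
  have h1 : HasDerivAt (fun s : ℝ => (s : ℂ) * a) a s := by
    simpa using (Complex.ofRealCLM.hasDerivAt (x := s)).mul_const a
  exact h.differentiableAt.hasDerivAt.comp s h1

theorem contDiffAt_ray {ψ : ℂ → ℂ} {a : ℂ} {s : ℝ} (h : AnalyticAt ℂ ψ (s * a)) :
    ContDiffAt ℝ ∞ (ray ψ a) s := by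
  have h1 : ContDiffAt ℝ ∞ (fun s : ℝ => (s : ℂ) * a) s :=
    Complex.ofRealCLM.contDiff.contDiffAt.mul contDiffAt_const
  exact (h.contDiffAt.restrict_scalars ℝ).comp s h1

theorem isRegularOn_ray {ψ : ℂ → ℂ} {r : ℝ} {a : ℂ} (ha : a ≠ 0) (har : ‖a‖ < r)
    (h : ∀ w ∈ Metric.ball (0 : ℂ) r, AnalyticAt ℂ ψ w ∧ deriv ψ w ≠ 0) {b c : ℝ}
    (hb : -1 ≤ b) (hbc : b < c) (hc : c ≤ 1) : IsRegularOn (ray ψ a) b c := by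
  have h1 : ∀ s ∈ Icc b c, (s : ℂ) * a ∈ Metric.ball (0 : ℂ) r := fun s hs =>
    ofReal_mul_mem_ball har ⟨hb.trans hs.1, hs.2.trans hc⟩
  refine ⟨fun s hs => (contDiffAt_ray (h _ (h1 s hs)).1).contDiffWithinAt, fun s hs => ?_⟩
  rw [(hasDerivAt_ray (h _ (h1 s hs)).1).hasDerivWithinAt.derivWithin
    (uniqueDiffOn_Icc hbc s hs)]
  exact mul_ne_zero (h _ (h1 s hs)).2 ha

theorem isSmoothArcThrough_ray {ψ : ℂ → ℂ} {r : ℝ} {a : ℂ} (ha : a ≠ 0) (har : ‖a‖ < r)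
    (hinj : InjOn ψ (Metric.ball 0 r))
    (h : ∀ w ∈ Metric.ball (0 : ℂ) r, AnalyticAt ℂ ψ w ∧ deriv ψ w ≠ 0) :
    IsSmoothArcThrough (ray ψ a) (ψ 0) := by
  refine ⟨isRegularOn_ray ha har h le_rfl (by norm_num) le_rfl, fun s hs t ht hst => ?_, ?_⟩
  · have := hinj (ofReal_mul_mem_ball har hs) (ofReal_mul_mem_ball har ht) hst
    exact_mod_cast mul_right_cancel₀ ha this
  · simp [ray]

/-- The directions of the `k` lines that make up `{w | Re w ^ k = 0}`. -/
def direction (k : ℕ) (j : ℕ) : ℂ :=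
  Complex.exp (((Real.pi / 2 + Real.pi * j) / k : ℝ) * Complex.I)

theorem norm_direction (k j : ℕ) : ‖direction k j‖ = 1 := Complex.norm_exp_ofReal_mul_I _

theorem direction_pow {k : ℕ} (hk : k ≠ 0) (j : ℕ) : direction k j ^ k = Complex.I * (-1) ^ j := by
  rw [direction, ← Complex.exp_nat_mul]
  have hk' : (k : ℂ) ≠ 0 := Nat.cast_ne_zero.2 hk
  have : (k : ℂ) * (((Real.pi / 2 + Real.pi * j) / k : ℝ) * Complex.I) =
      Real.pi / 2 * Complex.I + j * (Real.pi * Complex.I) := by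
    push_cast
    field_simp
  rw [this, Complex.exp_add, Complex.exp_pi_div_two_mul_I, Complex.exp_nat_mul,
    Complex.exp_pi_mul_I]

theorem re_mul_direction_pow {k : ℕ} (hk : k ≠ 0) (j : ℕ) (x : ℝ) :
    ((x * direction k j) ^ k).re = 0 := by
  have h : ((-1 : ℂ)) ^ j = (((-1 : ℝ) ^ j : ℝ) : ℂ) := by push_cast; rfl
  rw [mul_pow, direction_pow hk, h, ← Complex.ofReal_pow, Complex.re_ofReal_mul, Complex.re_mul_ofReal]
  simp

theorem exists_eq_mul_direction {k : ℕ} (hk : k ≠ 0) {w : ℂ} (hw : (w ^ k).re = 0) :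
    ∃ j : Fin k, ∃ x : ℝ, w = x * direction k j := by
  have hk' : (k : ℝ) ≠ 0 := Nat.cast_ne_zero.2 hk
  rcases eq_or_ne w 0 with rfl | hw0
  · exact ⟨⟨0, Nat.pos_of_ne_zero hk⟩, 0, by simp⟩
  rw [← Complex.norm_mul_exp_arg_mul_I w, mul_pow, ← Complex.exp_nat_mul, ← Complex.ofReal_pow,
    Complex.re_ofReal_mul, ← mul_assoc, ← Complex.ofReal_natCast, ← Complex.ofReal_mul,
    Complex.exp_ofReal_mul_I_re, mul_eq_zero, Real.cos_eq_zero_iff] at hw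
  obtain ⟨l, hl⟩ := hw.resolve_left (pow_ne_zero _ (norm_ne_zero_iff.2 hw0))
  have hk0 : (0 : ℤ) < k := by exact_mod_cast Nat.pos_of_ne_zero hk
  have hj0 := Int.emod_nonneg l hk0.ne'
  have hj1 := Int.emod_lt_of_pos l hk0
  -- The condition is `k arg w = π / 2 + π l`. The remainder of `l` modulo `k` selects the line, and
  -- the quotient only contributes a sign.
  refine ⟨⟨(l % k).toNat, by omega⟩, ‖w‖ * (-1) ^ (l / k), ?_⟩
  have hj : (((l % k).toNat : ℕ) : ℝ) = l - k * (l / k : ℤ) := by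
    have : (((l % k).toNat : ℕ) : ℤ) = l - k * (l / k) := by
      rw [Int.toNat_of_nonneg hj0, Int.emod_def]
    exact_mod_cast this
  have harg : w.arg = (Real.pi / 2 + Real.pi * ((l % k).toNat : ℕ)) / k + (l / k : ℤ) * Real.pi := by
    rw [hj]
    field_simp
    linear_combination 2 * hl
  conv_lhs => rw [← Complex.norm_mul_exp_arg_mul_I w, harg]
  rw [direction, Complex.ofReal_add, add_mul, Complex.exp_add]
  have h2 : Complex.exp ((((l / k : ℤ) * Real.pi : ℝ) : ℂ) * Complex.I) = (-1) ^ (l / k) := by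
    push_cast
    rw [mul_assoc, Complex.exp_int_mul, Complex.exp_pi_mul_I]
  rw [h2]
  push_cast
  ring

/-- After division by the first direction the imaginary part is `t sin (π (j - i) / k)`, and the
sine is nonzero because `0 < |j - i| < k`. -/
theorem direction_linearIndependent {k : ℕ} {i j : Fin k} (hij : i ≠ j) {s t : ℝ}
    (h : s * direction k i + t * direction k j = 0) : s = 0 ∧ t = 0 := by
  have hk : (0 : ℝ) < k := by exact_mod_cast i.pos
  have h1 : (s : ℂ) + t * Complex.exp ((Real.pi * ((j : ℝ) - i) / k : ℝ) * Complex.I) = 0 := by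
    have h2 : direction k j =
        direction k i * Complex.exp ((Real.pi * ((j : ℝ) - i) / k : ℝ) * Complex.I) := by
      rw [direction, direction, ← Complex.exp_add, ← add_mul, ← Complex.ofReal_add]
      congr 3
      ring
    have h3 : direction k i ≠ 0 := Complex.exp_ne_zero _
    rw [h2] at h
    apply mul_left_cancel₀ h3
    linear_combination h
  have him := congrArg Complex.im h1
  rw [Complex.add_im, Complex.im_ofReal_mul, Complex.exp_ofReal_mul_I_im, Complex.ofReal_im,
    zero_add, Complex.zero_im, mul_eq_zero] at him
  have hsin : Real.sin (Real.pi * ((j : ℝ) - i) / k) ≠ 0 := by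
    have hi : (i : ℝ) < k := by exact_mod_cast i.2
    have hj : (j : ℝ) < k := by exact_mod_cast j.2
    have hi0 : (0 : ℝ) ≤ (i : ℕ) := Nat.cast_nonneg _
    have hj0 : (0 : ℝ) ≤ (j : ℕ) := Nat.cast_nonneg _
    rw [Ne, Real.sin_eq_zero_iff_of_lt_of_lt]
    · have : ((j : ℕ) : ℝ) - (i : ℕ) ≠ 0 := by
        rw [sub_ne_zero]
        exact fun h => hij (Fin.ext (by exact_mod_cast h.symm))
      have := Real.pi_ne_zero
      positivity
    · rw [lt_div_iff₀ hk]
      nlinarith [Real.pi_pos]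
    · rw [div_lt_iff₀ hk]
      nlinarith [Real.pi_pos]
  have ht := him.resolve_right hsin
  subst ht
  simpa using h1

end RankOne

end

noncomputable section

namespace RankOne

/-! ### Crossings and right angles in the local model -/

theorem ray_direction_subset {S : Set ℂ} {ψ : ℂ → ℂ} {r ρ : ℝ} {k : ℕ} (hk : k ≠ 0)
    (hρ : 0 < ρ) (hρr : ρ < r)
    (hS : ∀ w ∈ Metric.ball (0 : ℂ) r, (ψ w ∈ S ↔ (w ^ k).re = 0)) (j : Fin k) :
    ray ψ (ρ * direction k j) '' Icc (-1) 1 ⊆ S := by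
  rintro _ ⟨s, hs, rfl⟩
  have hn : ‖(ρ : ℂ) * direction k j‖ < r := by
    rwa [norm_mul, norm_direction, mul_one, Complex.norm_real, Real.norm_eq_abs, abs_of_pos hρ]
  refine (hS _ (ofReal_mul_mem_ball hn hs)).2 ?_
  rw [← mul_assoc, ← Complex.ofReal_mul]
  exact re_mul_direction_pow hk _ _

theorem exists_eq_mul_mul_direction {k : ℕ} (hk : k ≠ 0) {ρ : ℝ} (hρ : 0 < ρ) {w : ℂ}
    (hwρ : w ∈ Metric.ball (0 : ℂ) ρ) (hw : (w ^ k).re = 0) :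
    ∃ j : Fin k, ∃ s ∈ Icc (-1 : ℝ) 1, w = s * (ρ * direction k j) := by
  obtain ⟨j, x, rfl⟩ := exists_eq_mul_direction hk hw
  rw [mem_ball_zero_iff, norm_mul, norm_direction, mul_one, Complex.norm_real, Real.norm_eq_abs,
    abs_lt] at hwρ
  refine ⟨j, x / ρ, ⟨?_, ?_⟩, ?_⟩
  · rw [le_div_iff₀ hρ]; linarith
  · rw [div_le_iff₀ hρ]; linarith
  · have : (ρ : ℂ) ≠ 0 := by exact_mod_cast hρ.ne'
    push_cast
    field_simp

theorem image_mem_nhdsWithin {S T : Set ℂ} {z : ℂ} {ψ : ℂ → ℂ} {r ρ : ℝ} {k : ℕ} (hk : k ≠ 0)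
    (hρ : 0 < ρ) (hρr : ρ < r) (hnhds : ψ '' Metric.ball 0 ρ ∈ 𝓝 z)
    (hS : ∀ w ∈ Metric.ball (0 : ℂ) r, (ψ w ∈ S ↔ (w ^ k).re = 0))
    (hT : ∀ j : Fin k, ray ψ (ρ * direction k j) '' Icc (-1) 1 ⊆ T) : T ∈ 𝓝[S] z := by
  rw [mem_nhdsWithin_iff_exists_mem_nhds_inter]
  refine ⟨_, hnhds, ?_⟩
  rintro _ ⟨⟨w, hw, rfl⟩, hwS⟩
  obtain ⟨j, s, hs, rfl⟩ := exists_eq_mul_mul_direction hk hρ hw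
    ((hS _ (Metric.ball_subset_ball hρr.le hw)).1 hwS)
  exact hT j ⟨s, hs, rfl⟩

theorem LocalModel.isLocallyInterval {S : Set ℂ} {z : ℂ} (h : LocalModel S z 1) :
    IsLocallyInterval S z := by
  obtain ⟨ψ, r, hr, hz, hinj, hreg, hnhds, hS⟩ := h
  -- Half the radius keeps the closed arc inside the ball where the chart is controlled.
  have hρ : 0 < r / 2 := by positivity
  have hρr : r / 2 < r := by linarith
  have hn : ‖((r / 2 : ℝ) : ℂ) * direction 1 (0 : Fin 1)‖ < r := by
    rwa [norm_mul, norm_direction, mul_one, Complex.norm_real, Real.norm_eq_abs, abs_of_pos hρ]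
  have h0 : ((r / 2 : ℝ) : ℂ) * direction 1 (0 : Fin 1) ≠ 0 :=
    mul_ne_zero (by exact_mod_cast hρ.ne') (Complex.exp_ne_zero _)
  refine ⟨_, hz ▸ isSmoothArcThrough_ray h0 hn hinj hreg,
    ray_direction_subset one_ne_zero hρ hρr hS 0,
    image_mem_nhdsWithin one_ne_zero hρ hρr (hnhds _ hρ) hS fun j => ?_⟩
  rw [Subsingleton.elim j 0]

/-- The arcs are the chart images of segments on the `k` lines. Both disjointness off `z` and
transversality come from real independence of the directions, using injectivity of the chart and its
nonzero complex derivative. -/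
theorem LocalModel.isCrossing {S : Set ℂ} {z : ℂ} {k : ℕ} (hk : 2 ≤ k) (h : LocalModel S z k) :
    IsCrossing S z := by
  obtain ⟨ψ, r, hr, hz, hinj, hreg, hnhds, hS⟩ := h
  have hk0 : k ≠ 0 := by omega
  set ρ := r / 2 with hρdef
  have hρ : 0 < ρ := by positivity
  have hρr : ρ < r := by linarith
  have hρ0 : (ρ : ℂ) ≠ 0 := by exact_mod_cast hρ.ne'
  have hn : ∀ j : Fin k, ‖(ρ : ℂ) * direction k j‖ < r := fun j => by
    rwa [norm_mul, norm_direction, mul_one, Complex.norm_real, Real.norm_eq_abs, abs_of_pos hρ]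
  have h0 : ∀ j : Fin k, (ρ : ℂ) * direction k j ≠ 0 := fun j =>
    mul_ne_zero hρ0 (Complex.exp_ne_zero _)
  have harc : ∀ j : Fin k, IsSmoothArcThrough (ray ψ (ρ * direction k j)) z := fun j =>
    hz ▸ isSmoothArcThrough_ray (h0 j) (hn j) hinj hreg
  refine ⟨k, fun j => ray ψ (ρ * direction k j), hk, harc, fun i j hij => ?_, fun i j hij => ?_,
    iUnion_subset fun j => ray_direction_subset hk0 hρ hρr hS j,
    image_mem_nhdsWithin hk0 hρ hρr (hnhds _ hρ) hS fun j => subset_iUnion_of_subset j le_rfl⟩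
  · apply Subset.antisymm
    · rintro _ ⟨⟨s, hs, rfl⟩, ⟨t, ht, hst⟩⟩
      have h1 := hinj (ofReal_mul_mem_ball (hn j) ht) (ofReal_mul_mem_ball (hn i) hs) hst
      have h2 : (s : ℂ) * direction k i + ((-t : ℝ) : ℂ) * direction k j = 0 := by
        apply mul_left_cancel₀ hρ0
        push_cast
        linear_combination -h1
      rw [(direction_linearIndependent hij h2).1]
      exact (harc i).2.2
    · rintro _ rfl
      exact ⟨⟨0, by norm_num, (harc i).2.2⟩, ⟨0, by norm_num, (harc j).2.2⟩⟩
  · have hd : ∀ j : Fin k, deriv (ray ψ (ρ * direction k j)) 0 =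
        deriv ψ 0 * (ρ * direction k j) := fun j => by
      have h1 := hreg 0 (Metric.mem_ball_self hr)
      have h2 := hasDerivAt_ray (s := 0) (a := ρ * direction k j) (ψ := ψ) (by simpa using h1.1)
      rw [h2.deriv]
      simp
    rw [LinearIndependent.pair_iff]
    intro s t hst
    rw [hd, hd, Complex.real_smul, Complex.real_smul] at hst
    refine direction_linearIndependent hij (mul_left_cancel₀
      (mul_ne_zero (hreg 0 (Metric.mem_ball_self hr)).2 hρ0) ?_)
    linear_combination hst

/-! ### Right-angle corners. -/

/-- The corner made of the half-line `[0, ∞)`, for `0 ≤ s`, and the half-line `i [0, ∞)`,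
for `s ≤ 0`. -/
def cornerPoint (s : ℝ) : ℂ := ⟨max s 0, max (-s) 0⟩

theorem cornerPoint_of_nonneg {s : ℝ} (hs : 0 ≤ s) : cornerPoint s = s := by
  simp [cornerPoint, Complex.ext_iff, hs]

theorem cornerPoint_of_nonpos {s : ℝ} (hs : s ≤ 0) : cornerPoint s = -s * Complex.I := by
  simp [cornerPoint, Complex.ext_iff, hs]

/-- The parameter is recovered as real part minus imaginary part. -/
theorem cornerPoint_injective : Function.Injective cornerPoint := by
  intro s t h
  have h1 := congrArg (fun z : ℂ => z.re - z.im) h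
  simpa [cornerPoint, max_comm, max_zero_sub_eq_self] using h1

/-- The corner lies in the closed first quadrant, which meets its negative only at the origin. -/
theorem cornerPoint_eq_neg {s t : ℝ} (h : cornerPoint s = -cornerPoint t) : s = 0 := by
  rw [Complex.ext_iff] at h
  simp only [cornerPoint, Complex.neg_re, Complex.neg_im] at h
  have h1 := le_max_left s 0
  have h2 := le_max_left (-s) 0
  have h3 := le_max_right t 0
  have h4 := le_max_right (-t) 0
  linarith

/-- The image of the corner `cornerPoint` under `w ↦ ψ (w a)`. -/
def corner (ψ : ℂ → ℂ) (a : ℂ) (s : ℝ) : ℂ := ψ (cornerPoint s * a)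

theorem corner_eqOn_Icc_zero_one (ψ : ℂ → ℂ) (a : ℂ) :
    EqOn (corner ψ a) (ray ψ a) (Icc 0 1) := fun s hs => by
  rw [corner, ray, cornerPoint_of_nonneg hs.1]

theorem corner_eqOn_Icc_neg_one_zero (ψ : ℂ → ℂ) (a : ℂ) :
    EqOn (corner ψ a) (ray ψ (-(Complex.I * a))) (Icc (-1) 0) := fun s hs => by
  rw [corner, ray, cornerPoint_of_nonpos hs.2]
  congr 1
  ring

theorem IsRegularOn.congr {γ δ : ℝ → ℂ} {a b : ℝ} (h : IsRegularOn γ a b)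
    (hδ : EqOn δ γ (Icc a b)) : IsRegularOn δ a b :=
  ⟨h.1.congr hδ, fun s hs => by rw [derivWithin_congr hδ (hδ hs)]; exact h.2 s hs⟩

theorem cornerPoint_mul_mem_ball {a : ℂ} {r s : ℝ} (ha : ‖a‖ < r) (hs : s ∈ Icc (-1 : ℝ) 1) :
    cornerPoint s * a ∈ Metric.ball (0 : ℂ) r := by
  rcases le_total 0 s with h | h
  · rw [cornerPoint_of_nonneg h]
    exact ofReal_mul_mem_ball ha hs
  · rw [cornerPoint_of_nonpos h]
    have := ofReal_mul_mem_ball (a := -(Complex.I * a)) (by simpa using ha) hs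
    convert this using 1
    ring

theorem isRightAngleCorner_corner {ψ : ℂ → ℂ} {r : ℝ} {a : ℂ} (ha : a ≠ 0) (har : ‖a‖ < r)
    (hinj : InjOn ψ (Metric.ball 0 r))
    (h : ∀ w ∈ Metric.ball (0 : ℂ) r, AnalyticAt ℂ ψ w ∧ deriv ψ w ≠ 0) :
    IsRightAngleCorner (corner ψ a) (ψ 0) (deriv ψ 0 * a) := by
  have h0 := h 0 (Metric.mem_ball_self ((norm_nonneg a).trans_lt har))
  have hIa : ‖-(Complex.I * a)‖ < r := by simpa using har
  have hIa0 : -(Complex.I * a) ≠ 0 := by simpa using ha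
  have hd : ∀ b : ℂ, HasDerivAt (ray ψ b) (deriv ψ 0 * b) 0 := fun b => by
    have h2 := hasDerivAt_ray (s := 0) (a := b) (ψ := ψ) (by simpa using h0.1)
    simpa using h2
  have e1 := corner_eqOn_Icc_zero_one ψ a
  have e2 := corner_eqOn_Icc_neg_one_zero ψ a
  refine ⟨mul_ne_zero h0.2 ha, by simp [corner, cornerPoint_of_nonneg], fun s hs t ht hst => ?_,
    (isRegularOn_ray hIa0 hIa h le_rfl (by norm_num) zero_le_one).congr e2,
    (isRegularOn_ray ha har h (by norm_num) zero_lt_one le_rfl).congr e1,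
    (hd a).hasDerivWithinAt.congr e1 (e1 (by norm_num)), ?_⟩
  · exact cornerPoint_injective (mul_right_cancel₀ ha
      (hinj (cornerPoint_mul_mem_ball har hs) (cornerPoint_mul_mem_ball har ht) hst))
  · rw [show -(Complex.I * (deriv ψ 0 * a)) = deriv ψ 0 * -(Complex.I * a) by ring]
    exact (hd (-(Complex.I * a))).hasDerivWithinAt.congr e2 (e2 (by norm_num))

/-- A derivative would equal both one-sided values, so `w = -i w`, that is `(1 + i) w = 0`. -/
theorem IsRightAngleCorner.not_differentiableAt {γ : ℝ → ℂ} {z w : ℂ}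
    (h : IsRightAngleCorner γ z w) : ¬ DifferentiableAt ℝ γ 0 := by
  obtain ⟨hw, -, -, -, -, h1, h2⟩ := h
  intro hd
  have e1 := (uniqueDiffOn_Icc (zero_lt_one' ℝ) 0 (by norm_num)).eq_deriv _ h1
    hd.hasDerivAt.hasDerivWithinAt
  have e2 := (uniqueDiffOn_Icc (show (-1 : ℝ) < 0 by norm_num) 0 (by norm_num)).eq_deriv _ h2
    hd.hasDerivAt.hasDerivWithinAt
  have h3 : (1 + Complex.I) * w = 0 := by linear_combination e1 - e2
  rcases mul_eq_zero.1 h3 with h4 | h4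
  · simpa using congrArg Complex.re h4
  · exact hw h4

/-- The zero set of `Re w ^ 2` is the two lines through `a` and `i a`. Its four half-lines are
regrouped into the corners `a, i a` and `-a, -i a`, and the chart preserves angles at the origin. -/
theorem LocalModel.isRightAngleMeeting {S : Set ℂ} {z : ℂ} (h : LocalModel S z 2) :
    IsRightAngleMeeting S z := by
  obtain ⟨ψ, r, hr, hz, hinj, hreg, hnhds, hS⟩ := h
  set ρ := r / 2 with hρdef
  have hρ : 0 < ρ := by positivity
  have hρr : ρ < r := by linarith
  have hρ0 : (ρ : ℂ) ≠ 0 := by exact_mod_cast hρ.ne'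
  set a : ℂ := ρ * direction 2 0 with ha
  have hn : ‖a‖ < r := by
    rwa [ha, norm_mul, norm_direction, mul_one, Complex.norm_real, Real.norm_eq_abs, abs_of_pos hρ]
  have ha0 : a ≠ 0 := mul_ne_zero hρ0 (Complex.exp_ne_zero _)
  have hn' : ‖-a‖ < r := by rwa [norm_neg]
  have hd1 : (ρ : ℂ) * direction 2 1 = Complex.I * a := by
    have : direction 2 1 = Complex.I * direction 2 0 := by
      calc direction 2 1 = Complex.exp (Real.pi / 2 * Complex.I) * direction 2 0 := by
            rw [direction, direction, ← Complex.exp_add]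
            congr 1
            push_cast
            ring
        _ = Complex.I * direction 2 0 := by rw [Complex.exp_pi_div_two_mul_I]
    rw [ha, this]
    ring
  have hray : ∀ b : ℂ, (∃ j : Fin 2, b = ρ * direction 2 j) →
      ray ψ b '' Icc (-1) 1 ⊆ S := by
    rintro _ ⟨j, rfl⟩
    exact ray_direction_subset two_ne_zero hρ hρr hS j
  have hcS : ∀ b : ℂ, b = a ∨ b = -a → corner ψ b '' Icc (-1) 1 ⊆ S := by
    rintro b hb _ ⟨s, hs, rfl⟩
    have h1 : ray ψ a s ∈ S ∧ ray ψ a (-s) ∈ S :=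
      ⟨hray a ⟨0, rfl⟩ ⟨s, hs, rfl⟩, hray a ⟨0, rfl⟩ ⟨-s, ⟨by linarith [hs.2], by linarith [hs.1]⟩, rfl⟩⟩
    have h2 : ray ψ (Complex.I * a) s ∈ S ∧ ray ψ (Complex.I * a) (-s) ∈ S :=
      ⟨hray _ ⟨1, hd1.symm⟩ ⟨s, hs, rfl⟩,
        hray _ ⟨1, hd1.symm⟩ ⟨-s, ⟨by linarith [hs.2], by linarith [hs.1]⟩, rfl⟩⟩
    simp only [ray, Complex.ofReal_neg] at h1 h2
    rw [corner]
    rcases le_total 0 s with h | h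
    · rw [cornerPoint_of_nonneg h]
      rcases hb with rfl | rfl
      · exact h1.1
      · rw [mul_neg, ← neg_mul]
        exact h1.2
    · rw [cornerPoint_of_nonpos h]
      rcases hb with rfl | rfl
      · rw [mul_assoc]
        exact h2.2
      · rw [show -(s : ℂ) * Complex.I * -a = s * (Complex.I * a) by ring]
        exact h2.1
  have hc1 := isRightAngleCorner_corner ha0 hn hinj hreg
  have hc2 := isRightAngleCorner_corner (neg_ne_zero.2 ha0) hn' hinj hreg
  rw [hz] at hc1 hc2
  rw [mul_neg] at hc2
  refine ⟨deriv ψ 0 * a, corner ψ a, corner ψ (-a), hc1, hc2, hc1.not_differentiableAt,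
    hc2.not_differentiableAt, ?_, union_subset (hcS _ (.inl rfl)) (hcS _ (.inr rfl)),
    image_mem_nhdsWithin two_ne_zero hρ hρr (hnhds _ hρ) hS fun j => ?_⟩
  · apply Subset.antisymm
    · rintro _ ⟨⟨s, hs, rfl⟩, ⟨t, ht, hst⟩⟩
      have h1 := hinj (cornerPoint_mul_mem_ball hn' ht) (cornerPoint_mul_mem_ball hn hs) hst
      have h2 : cornerPoint s = -cornerPoint t := by
        apply mul_right_cancel₀ ha0
        linear_combination -h1
      rw [cornerPoint_eq_neg h2]
      exact hc1.2.1
    · rintro _ rfl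
      exact ⟨⟨0, by norm_num, hc1.2.1⟩, ⟨0, by norm_num, hc2.2.1⟩⟩
  · rintro _ ⟨s, hs, rfl⟩
    have hs' : -s ∈ Icc (-1 : ℝ) 1 := ⟨by linarith [hs.2], by linarith [hs.1]⟩
    fin_cases j
    · rcases le_total 0 s with h | h
      · exact .inl ⟨s, hs, by simp [corner, ray, cornerPoint_of_nonneg h, ha]⟩
      · exact .inr ⟨-s, hs', by
          simp [corner, ray, cornerPoint_of_nonneg (neg_nonneg.2 h), ha]⟩
    · have h3 : ray ψ ((ρ : ℂ) * direction 2 ((⟨1, by omega⟩ : Fin 2) : ℕ)) s =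
          ψ (s * (Complex.I * a)) := by
        rw [ray, ← hd1]
      rcases le_total 0 s with h | h
      · refine .inl ⟨-s, hs', h3 ▸ ?_⟩
        rw [corner, cornerPoint_of_nonpos (neg_nonpos.2 h)]
        congr 1
        push_cast
        ring
      · refine .inr ⟨s, hs, h3 ▸ ?_⟩
        rw [corner, cornerPoint_of_nonpos h]
        congr 1
        ring

end RankOne

end

noncomputable section

namespace RankOne

/-! ### Compact regular level sets are unions of smooth closed curves -/

section ClosedCurves

/-- The compact set `S` is, near each of its points, the level set `‖f‖ = c` of a holomorphic
function without critical points. -/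
structure IsRegularLevel (f : ℂ → ℂ) (c : ℝ) (S : Set ℂ) : Prop where
  pos : 0 < c
  isCompact : IsCompact S
  analyticAt : ∀ z ∈ S, AnalyticAt ℂ f z
  deriv_ne_zero : ∀ z ∈ S, deriv f z ≠ 0
  eventually_mem_iff : ∀ z ∈ S, ∀ᶠ w in 𝓝 z, w ∈ S ↔ ‖f w‖ = c

variable {f : ℂ → ℂ} {c : ℝ} {S : Set ℂ}

namespace IsRegularLevel

theorem norm_eq (h : IsRegularLevel f c S) {z : ℂ} (hz : z ∈ S) : ‖f z‖ = c :=
  (h.eventually_mem_iff z hz).self_of_nhds.1 hz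

theorem exists_chart (h : IsRegularLevel f c S) {z : ℂ} (hz : z ∈ S) :
    ∃ e : OpenPartialHomeomorph ℂ ℂ, z ∈ e.source ∧ (e : ℂ → ℂ) = f := by
  have hsd := (h.analyticAt z hz).hasStrictDerivAt.hasStrictFDerivAt_equiv (h.deriv_ne_zero z hz)
  exact ⟨_, hsd.mem_toOpenPartialHomeomorph_source, hsd.toOpenPartialHomeomorph_coe⟩

/-- The restriction of `f` to the level set, as a map to the circle. -/
def toSphere (h : IsRegularLevel f c S) (z : S) : Metric.sphere (0 : ℂ) c :=
  ⟨f z, mem_sphere_zero_iff_norm.2 (h.norm_eq z.2)⟩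

theorem continuous_toSphere (h : IsRegularLevel f c S) : Continuous h.toSphere := by
  refine Continuous.subtype_mk (continuous_iff_continuousAt.2 fun z => ?_) _
  exact (h.analyticAt z z.2).continuousAt.comp continuous_subtype_val.continuousAt

/-- Local injectivity is that of the chart `f`. Openness uses that, near a point of `S`, every point
whose value has modulus `c` belongs to `S`. -/
theorem isLocalHomeomorph_toSphere (h : IsRegularLevel f c S) :
    IsLocalHomeomorph h.toSphere := by
  rw [isLocalHomeomorph_iff_isOpenEmbedding_restrict]
  intro z
  obtain ⟨e, hze, hef⟩ := h.exists_chart z.2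
  obtain ⟨V, hV, hVo, hzV⟩ := eventually_nhds_iff.1 (h.eventually_mem_iff z z.2)
  set U : Set ℂ := e.source ∩ V with hU
  have hUo : IsOpen U := e.open_source.inter hVo
  refine ⟨Subtype.val ⁻¹' U, (hUo.preimage continuous_subtype_val).mem_nhds ⟨hze, hzV⟩,
    IsOpenEmbedding.of_continuous_injective_isOpenMap
      (h.continuous_toSphere.comp continuous_subtype_val) ?_ ?_⟩
  · intro x y hxy
    have h1 : f x.1.1 = f y.1.1 := congrArg Subtype.val hxy
    rw [← hef] at h1
    exact Subtype.ext (Subtype.ext (e.injOn x.2.1 y.2.1 h1))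
  · intro W hW
    obtain ⟨W₁, hW₁, rfl⟩ := isOpen_induced_iff.1 hW
    obtain ⟨W₂, hW₂, rfl⟩ := isOpen_induced_iff.1 hW₁
    have ho : IsOpen (e '' (W₂ ∩ U)) :=
      e.isOpen_image_of_subset_source (hW₂.inter hUo) fun x hx => hx.2.1
    convert ho.preimage continuous_subtype_val using 1
    ext y
    constructor
    · rintro ⟨x, hx, rfl⟩
      exact ⟨x.1.1, ⟨hx, x.2⟩, by rw [hef]; rfl⟩
    · rintro ⟨x, ⟨hx, hxU⟩, hxy⟩
      rw [hef] at hxy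
      have hxS : x ∈ S := (hV x hxU.2).2 (by rw [hxy]; exact mem_sphere_zero_iff_norm.1 y.2)
      exact ⟨⟨⟨x, hxS⟩, hxU⟩, hx, Subtype.ext hxy⟩

theorem isCoveringMap_toSphere (h : IsRegularLevel f c S) : IsCoveringMap h.toSphere := by
  have := isCompact_iff_compactSpace.1 h.isCompact
  exact isLocalHomeomorph_iff_isCoveringMap.1 h.isLocalHomeomorph_toSphere

theorem finite_fiber (h : IsRegularLevel f c S) (y : Metric.sphere (0 : ℂ) c) :
    (h.toSphere ⁻¹' {y}).Finite := by
  have := isCompact_iff_compactSpace.1 h.isCompact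
  have := (h.isCoveringMap_toSphere y).discreteTopology_fiber
  exact (isClosed_singleton.preimage h.continuous_toSphere).isCompact.finite ⟨this⟩

/-! ### The rotation flow and its orbits. -/

/-- The path that turns `f z` around the origin with unit speed. -/
def rotation (h : IsRegularLevel f c S) (z : S) : C(ℝ, Metric.sphere (0 : ℂ) c) where
  toFun s := ⟨f z * Complex.exp (s * Complex.I), by
    rw [mem_sphere_zero_iff_norm, norm_mul, Complex.norm_exp_ofReal_mul_I, mul_one,
      h.norm_eq z.2]⟩
  continuous_toFun := by fun_prop

theorem existsUnique_lift (h : IsRegularLevel f c S) (z : S) :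
    ∃! F : C(ℝ, S), F 0 = z ∧ h.toSphere ∘ F = h.rotation z :=
  h.isCoveringMap_toSphere.existsUnique_continuousMap_lifts (h.rotation z) 0 z
    (Subtype.ext (by simp [toSphere, rotation]))

/-- The flow on the level set that turns the value of `f` with unit speed. -/
def flow (h : IsRegularLevel f c S) (z : S) : C(ℝ, S) := (h.existsUnique_lift z).choose

theorem flow_zero (h : IsRegularLevel f c S) (z : S) : h.flow z 0 = z :=
  (h.existsUnique_lift z).choose_spec.1.1

theorem apply_flow (h : IsRegularLevel f c S) (z : S) (s : ℝ) :
    f (h.flow z s) = f z * Complex.exp (s * Complex.I) :=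
  congrArg Subtype.val (congrFun (h.existsUnique_lift z).choose_spec.1.2 s)

/-- Both sides, as functions of `t`, lift the same path from the same initial point, so uniqueness
of lifts applies. -/
theorem flow_add (h : IsRegularLevel f c S) (z : S) (s t : ℝ) :
    h.flow z (s + t) = h.flow (h.flow z s) t := by
  set F : C(ℝ, S) := (h.flow z).comp ⟨fun t => s + t, by fun_prop⟩ with hF
  have h1 : F = h.flow (h.flow z s) := by
    refine (h.existsUnique_lift (h.flow z s)).unique ⟨?_, ?_⟩
      (h.existsUnique_lift (h.flow z s)).choose_spec.1
    · simp [hF]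
    · funext t
      apply Subtype.ext
      change f (h.flow z (s + t)) = f (h.flow z s) * _
      rw [h.apply_flow, h.apply_flow, mul_assoc, ← Complex.exp_add]
      push_cast
      ring_nf
  exact congrArg (fun G : C(ℝ, S) => G t) h1

/-- Locally the flow is a holomorphic inverse branch of `f` applied to a smooth rotation. -/
theorem contDiff_flow (h : IsRegularLevel f c S) (z : S) :
    ContDiff ℝ ∞ (fun s => (h.flow z s : ℂ)) := by
  rw [contDiff_iff_contDiffAt]
  intro s
  obtain ⟨e, hze, hef⟩ := h.exists_chart (h.flow z s).2
  have hcont : Continuous fun s => (h.flow z s : ℂ) :=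
    continuous_subtype_val.comp (h.flow z).continuous
  have hev : (fun s => (h.flow z s : ℂ)) =ᶠ[𝓝 s]
      fun s => e.symm (f z * Complex.exp (s * Complex.I)) := by
    filter_upwards [hcont.continuousAt.eventually (e.open_source.mem_nhds hze)] with t ht
    rw [show f z * Complex.exp (t * Complex.I) = e (h.flow z t) by rw [hef, h.apply_flow],
      e.left_inv ht]
  refine ContDiffAt.congr_of_eventuallyEq ?_ hev
  have h1 : f z * Complex.exp (s * Complex.I) = e (h.flow z s) := by rw [hef, h.apply_flow]
  have h2 : ContDiffAt ℂ ∞ e.symm (f z * Complex.exp (s * Complex.I)) := by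
    have ha := h.analyticAt _ (h.flow z s).2
    have h3 : e.symm (f z * Complex.exp (s * Complex.I)) = h.flow z s := by
      rw [h1, e.left_inv hze]
    refine e.contDiffAt_symm_deriv (h.deriv_ne_zero _ (h.flow z s).2) ?_ ?_ ?_
    · rw [h1]
      exact e.map_source hze
    · rw [h3, hef]
      exact ha.differentiableAt.hasDerivAt
    · rw [h3, hef]
      exact ha.contDiffAt
  have h4 : ContDiffAt ℝ ∞ (fun s : ℝ => f z * Complex.exp (s * Complex.I)) s := by
    have := Complex.ofRealCLM.contDiff (n := ∞)
    have h5 : ContDiff ℝ ∞ fun s : ℝ => (s : ℂ) := this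
    fun_prop
  exact (h2.restrict_scalars ℝ).comp s h4

/-- By the chain rule, a zero velocity would stop the value of `f`, which turns with unit angular
speed around `0` at radius `c > 0`. -/
theorem deriv_flow_ne_zero (h : IsRegularLevel f c S) (z : S) (s : ℝ) :
    deriv (fun s => (h.flow z s : ℂ)) s ≠ 0 := by
  intro h0
  have hd := ((h.contDiff_flow z).differentiable (by simp) s).hasDerivAt
  rw [h0] at hd
  have h1 := (h.analyticAt _ (h.flow z s).2).differentiableAt.hasDerivAt.comp s hd
  have h2 : HasDerivAt (fun s : ℝ => f z * Complex.exp (s * Complex.I))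
      (f z * (Complex.exp (s * Complex.I) * (1 * Complex.I))) s :=
    (((Complex.ofRealCLM.hasDerivAt (x := s)).mul_const Complex.I).cexp).const_mul (f z)
  have h3 : (f ∘ fun s => (h.flow z s : ℂ)) = fun s : ℝ => f z * Complex.exp (s * Complex.I) :=
    funext fun s => h.apply_flow z s
  rw [h3] at h1
  have h4 := h1.unique h2
  have h5 : f z ≠ 0 := norm_ne_zero_iff.1 (by rw [h.norm_eq z.2]; exact h.pos.ne')
  simp [h5, Complex.exp_ne_zero] at h4

/-- At the times `2πn` the orbit returns to the finite fibre over `f z`; two of these points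
coincide, and flowing backwards gives a return to `z`. -/
theorem exists_period (h : IsRegularLevel f c S) (z : S) :
    ∃ m : ℕ, 0 < m ∧ h.flow z (2 * Real.pi * m) = z := by
  have hfin : Finite (h.toSphere ⁻¹' {h.toSphere z}) := h.finite_fiber _
  have hmem : ∀ n : ℕ, h.flow z (2 * Real.pi * n) ∈ h.toSphere ⁻¹' {h.toSphere z} := by
    intro n
    apply Subtype.ext
    change f (h.flow z (2 * Real.pi * n)) = f z
    rw [h.apply_flow]
    have : (((2 * Real.pi * n : ℝ) : ℂ)) * Complex.I = n * (2 * Real.pi * Complex.I) := by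
      push_cast
      ring
    rw [this, Complex.exp_nat_mul_two_pi_mul_I, mul_one]
  obtain ⟨i, j, hij, heq⟩ := Finite.exists_ne_map_eq_of_infinite
    (fun n : ℕ => (⟨_, hmem n⟩ : h.toSphere ⁻¹' {h.toSphere z}))
  wlog hlt : i < j generalizing i j
  · exact this j i hij.symm heq.symm (lt_of_le_of_ne (not_lt.1 hlt) hij.symm)
  have heq' : h.flow z (2 * Real.pi * i) = h.flow z (2 * Real.pi * j) := congrArg Subtype.val heq
  refine ⟨j - i, Nat.sub_pos_of_lt hlt, ?_⟩
  have h1 := h.flow_add z (2 * Real.pi * j) (-(2 * Real.pi * i))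
  rw [← heq', ← flow_add, add_neg_cancel, flow_zero] at h1
  rwa [← sub_eq_add_neg, ← mul_sub, ← Nat.cast_sub hlt.le] at h1

theorem isSmoothClosedCurve_range_flow (h : IsRegularLevel f c S) (z : S) :
    IsSmoothClosedCurve (range fun s => (h.flow z s : ℂ)) := by
  classical
  have hex := h.exists_period z
  -- The least number of turns before the orbit closes; rescaling time by it makes the period `2π`.
  set m := Nat.find hex with hm
  obtain ⟨hm0, hmz⟩ := Nat.find_spec hex
  rw [← hm] at hm0 hmz
  have hm0' : (0 : ℝ) < m := Nat.cast_pos.2 hm0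
  have hcd := h.contDiff_flow z
  refine ⟨fun s => h.flow z (m * s), hcd.comp (contDiff_const.mul contDiff_id), fun s => ?_, ?_,
    fun s => ?_, ?_⟩
  · have : (m : ℝ) * (s + 2 * Real.pi) = 2 * Real.pi * m + m * s := by ring
    simp only [this, flow_add, hmz]
  · have key : ∀ s ∈ Ico 0 (2 * Real.pi), ∀ t ∈ Ico 0 (2 * Real.pi), s ≤ t →
        (h.flow z (m * s) : ℂ) = h.flow z (m * t) → s = t := by
      intro s hs t ht hst heq
      have h1 := congrArg f heq
      have h5 : f z ≠ 0 := norm_ne_zero_iff.1 (by rw [h.norm_eq z.2]; exact h.pos.ne')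
      rw [h.apply_flow, h.apply_flow, mul_right_inj' h5, eq_comm,
        Complex.exp_eq_exp_iff_exists_int] at h1
      obtain ⟨l, hl⟩ := h1
      have hl' : (m : ℝ) * t = m * s + 2 * Real.pi * l := by
        have h2 : (((m * t : ℝ) : ℂ)) = ((m * s + 2 * Real.pi * l : ℝ) : ℂ) := by
          apply mul_right_cancel₀ Complex.I_ne_zero
          rw [hl]
          push_cast
          ring
        exact_mod_cast h2
      have hpi := Real.two_pi_pos
      have hl0 : (0 : ℝ) ≤ l := by
        by_contra hneg
        nlinarith [mul_le_mul_of_nonneg_left hst hm0'.le]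
      have hlm : (l : ℝ) < m := by
        by_contra hge
        nlinarith [mul_lt_mul_of_pos_left ht.2 hm0', mul_nonneg hm0'.le hs.1]
      lift l to ℕ using by exact_mod_cast hl0
      have hlm' : l < m := by exact_mod_cast hlm
      have hz : h.flow z (2 * Real.pi * l) = z := by
        have h3 := h.flow_add z (m * t) (-(m * s))
        rw [← Subtype.ext heq, ← flow_add, add_neg_cancel, flow_zero, hl'] at h3
        rwa [Int.cast_natCast, add_neg_cancel_comm] at h3
      rcases Nat.eq_zero_or_pos l with rfl | hlpos
      · simp only [Nat.cast_zero, Int.cast_zero, mul_zero, add_zero] at hl'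
        exact (mul_left_cancel₀ hm0'.ne' hl').symm
      · exact absurd ⟨hlpos, hz⟩ (Nat.find_min hex hlm')
    intro s hs t ht heq
    rcases le_total s t with hst | hst
    · exact key s hs t ht hst heq
    · exact (key t ht s hs hst heq.symm).symm
  · have h1 : HasDerivAt (fun s => (h.flow z (m * s) : ℂ))
        ((m * 1 : ℝ) • deriv (fun s => (h.flow z s : ℂ)) (m * s)) s :=
      HasDerivAt.scomp s (hcd.differentiable (by simp) (m * s)).hasDerivAt
        ((hasDerivAt_id s).const_mul (m : ℝ))
    rw [h1.deriv]
    exact smul_ne_zero (by simpa using hm0.ne') (h.deriv_flow_ne_zero z _)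
  · have hsurj : Function.Surjective fun s : ℝ => (m : ℝ) * s := mul_left_surjective₀ hm0'.ne'
    exact hsurj.range_comp fun s => (h.flow z s : ℂ)

theorem range_flow_eq_of_mem (h : IsRegularLevel f c S) {z w : S} (hw : w ∈ range (h.flow z)) :
    range (h.flow w) = range (h.flow z) := by
  obtain ⟨s, rfl⟩ := hw
  have h1 : ⇑(h.flow (h.flow z s)) = h.flow z ∘ fun t => s + t :=
    funext fun t => (h.flow_add z s t).symm
  rw [h1]
  exact (add_left_surjective s).range_comp _

theorem exists_smoothClosedCurves (h : IsRegularLevel f c S) :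
    ∃ (k : ℕ) (C : Fin k → Set ℂ), (∀ j, IsSmoothClosedCurve (C j)) ∧
      (∀ i j, i ≠ j → Disjoint (C i) (C j)) ∧ S = ⋃ j, C j := by
  -- Every orbit meets the fibre over the positive real point `c`, and this fibre is finite, so
  -- there are finitely many orbits.
  set y : Metric.sphere (0 : ℂ) c := ⟨c, by simp [abs_of_pos h.pos]⟩ with hy
  have hfin : ((fun z => range (h.flow z)) '' (h.toSphere ⁻¹' {y})).Finite :=
    (h.finite_fiber y).image _
  have hmeet : ∀ z : S, range (h.flow z) ∈ (fun z => range (h.flow z)) '' (h.toSphere ⁻¹' {y}) := by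
    intro z
    refine ⟨h.flow z (-(f z).arg), ?_, h.range_flow_eq_of_mem ⟨_, rfl⟩⟩
    apply Subtype.ext
    change f (h.flow z (-(f z).arg)) = c
    rw [h.apply_flow, ← h.norm_eq z.2]
    conv_lhs => rw [← Complex.norm_mul_exp_arg_mul_I (f z)]
    rw [mul_assoc, ← Complex.exp_add]
    simp
  set e := hfin.toFinset.equivFin.symm
  have he : ∀ j, ∃ z : S, (e j : Set S) = range (h.flow z) := fun j => by
    obtain ⟨z, -, hz⟩ := hfin.mem_toFinset.1 (e j).2
    exact ⟨z, hz.symm⟩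
  refine ⟨_, fun j => Subtype.val '' (e j : Set S), fun j => ?_, fun i j hij => ?_, ?_⟩
  · obtain ⟨z, hz⟩ := he j
    beta_reduce
    rw [hz, ← range_comp]
    exact h.isSmoothClosedCurve_range_flow z
  · rw [disjoint_image_iff Subtype.val_injective, Set.disjoint_left]
    intro w hwi hwj
    obtain ⟨z, hz⟩ := he i
    obtain ⟨z', hz'⟩ := he j
    rw [hz] at hwi
    rw [hz'] at hwj
    refine hij (e.injective (Subtype.ext ?_))
    rw [hz, hz', ← h.range_flow_eq_of_mem hwi, ← h.range_flow_eq_of_mem hwj]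
  · ext z
    rw [mem_iUnion]
    constructor
    · intro hz
      refine ⟨e.symm ⟨range (h.flow ⟨z, hz⟩), hfin.mem_toFinset.2 (hmeet _)⟩, ⟨z, hz⟩, ?_, rfl⟩
      rw [Equiv.apply_symm_apply]
      exact ⟨0, h.flow_zero _⟩
    · rintro ⟨j, w, -, rfl⟩
      exact w.2

end IsRegularLevel

end ClosedCurves

end RankOne

end

noncomputable section

namespace RankOne

open Polynomial Matrix

/-! ### Generic bilinear forms have no multiple zeros -/

theorem exists_map_eq_C_mul {R K : Type*} [CommRing R] [IsDomain R] [Field K] [Algebra R K]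
    [IsFractionRing R K] (p : K[X]) :
    ∃ r : R, r ≠ 0 ∧ ∃ p₀ : R[X], p₀.map (algebraMap R K) = C (algebraMap R K r) * p := by
  obtain ⟨b, hb, h⟩ := IsLocalization.integerNormalization_spec (nonZeroDivisors R) p
  refine ⟨b, nonZeroDivisors.ne_zero hb,
    IsLocalization.integerNormalization (nonZeroDivisors R) p, ?_⟩
  rw [h, ← smul_eq_C_mul, algebraMap_smul]

/-- This is the product rule. Since `d` acts only over `R`, the denominators of `π` and of the
cofactor are cleared first; the resulting constants are units over `K`. -/
theorem dvd_map_derivation_of_sq_dvd {R K : Type*} [CommRing R] [IsDomain R] [Field K]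
    [Algebra R K] [IsFractionRing R K] {d : R[X] → R[X]}
    (hd : ∀ a b, d (a * b) = a * d b + b * d a) {F : R[X]} {π : K[X]}
    (h : π ^ 2 ∣ F.map (algebraMap R K)) : π ∣ (d F).map (algebraMap R K) := by
  have hinj := IsFractionRing.injective R K
  obtain ⟨s, hs⟩ := h
  obtain ⟨a, ha, π₀, hπ₀⟩ := exists_map_eq_C_mul (R := R) π
  obtain ⟨b, hb, s₀, hs₀⟩ := exists_map_eq_C_mul (R := R) s
  set φ := algebraMap R K
  have hunit : ∀ r : R, r ≠ 0 → IsUnit (C (φ r)) := fun r hr =>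
    isUnit_C.2 (isUnit_iff_ne_zero.2 ((map_ne_zero_iff φ hinj).2 hr))
  have h1 : C (a ^ 2 * b) * F = π₀ * (π₀ * s₀) := by
    apply map_injective φ hinj
    simp only [Polynomial.map_mul, Polynomial.map_pow, map_C, hπ₀, hs₀, hs, map_mul, map_pow]
    ring
  have h2 := congrArg (fun p => (d p).map φ) h1
  simp only [hd, Polynomial.map_add, Polynomial.map_mul, map_C] at h2
  have h3 : π ∣ π₀.map φ := hπ₀ ▸ dvd_mul_left _ _
  have h4 : π ∣ F.map φ := hs ▸ (dvd_pow_self π two_ne_zero).mul_right _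
  have h5 : π ∣ C (φ (a ^ 2 * b)) * (d F).map φ := by
    rw [eq_sub_of_add_eq h2]
    refine dvd_sub (dvd_add (h3.mul_right _) ((h3.mul_right _).mul_right _)) (h4.mul_right _)
  exact (hunit _ (mul_ne_zero (pow_ne_zero 2 ha) hb)).dvd_mul_left.1 h5

/-- In characteristic zero an irreducible `π` is coprime to its derivative. The case `π = 0` is kept
for the zero ideal, which is also prime. -/
theorem sq_dvd_of_dvd_derivative {K : Type*} [Field K] [CharZero K] {F π : K[X]}
    (hπ : π = 0 ∨ Irreducible π) (h1 : π ∣ F) (h2 : π ∣ derivative F) : π ^ 2 ∣ F := by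
  rcases hπ with rfl | hπ
  · simpa using h1
  · obtain ⟨s, rfl⟩ := h1
    rw [derivative_mul, dvd_add_left (dvd_mul_right _ _)] at h2
    have hsep : IsCoprime π (derivative π) := hπ.separable
    rw [sq]
    exact mul_dvd_mul_left π (hsep.dvd_of_dvd_mul_left h2)

section Generic

variable {n : ℕ}

/-- The coordinate ring of the space of pairs of vectors. -/
abbrev PairRing (n : ℕ) : Type := MvPolynomial (Fin n ⊕ Fin n) ℂ

/-- The `i`-th entry of the product of `M` with the generic vector `u`. -/
def genericRow (M : Matrix (Fin n) (Fin n) ℂ[X]) (i : Fin n) : (PairRing n)[X] :=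
  ∑ j, C (MvPolynomial.X (Sum.inl j)) * (M i j).map MvPolynomial.C

/-- The bilinear form of `M` in generic vectors. -/
def genericForm (M : Matrix (Fin n) (Fin n) ℂ[X]) : (PairRing n)[X] :=
  ∑ i, C (MvPolynomial.X (Sum.inr i)) * genericRow M i

/-- The bilinear form of `M`. -/
def bilinForm (M : Matrix (Fin n) (Fin n) ℂ[X]) (x : Fin n ⊕ Fin n → ℂ) : ℂ[X] :=
  ∑ i, C (x (Sum.inr i)) * ∑ j, C (x (Sum.inl j)) * M i j

theorem map_genericForm (M : Matrix (Fin n) (Fin n) ℂ[X]) (x : Fin n ⊕ Fin n → ℂ) :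
    (genericForm M).map (MvPolynomial.eval x) = bilinForm M x := by
  have h : (MvPolynomial.eval x).comp (MvPolynomial.C : ℂ →+* PairRing n) = RingHom.id ℂ := by
    ext a
    simp
  simp [genericForm, genericRow, bilinForm, Polynomial.map_sum, Polynomial.map_map, h]

/-- The derivation is the partial derivative in the `i`-th coordinate of the second vector, taken
coefficientwise; the form is linear in that vector. -/
theorem exists_derivation_genericForm (M : Matrix (Fin n) (Fin n) ℂ[X]) (i : Fin n) :
    ∃ d : (PairRing n)[X] → (PairRing n)[X], (∀ a b, d (a * b) = a * d b + b * d a) ∧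
      d (genericForm M) = genericRow M i := by
  let _ : Differential (PairRing n) :=
    ⟨(MvPolynomial.pderiv (Sum.inr i)).restrictScalars ℤ⟩
  have hD : ∀ r : PairRing n, Differential.deriv r = MvPolynomial.pderiv (Sum.inr i) r :=
    fun r => rfl
  set d : (PairRing n)[X] →+ (PairRing n)[X] := Differential.mapCoeffs.toLinearMap.toAddMonoidHom
  have hcoeff : ∀ p k, (d p).coeff k = MvPolynomial.pderiv (Sum.inr i) (p.coeff k) := fun p k => rfl
  have hmul : ∀ a b, d (a * b) = a * d b + b * d a := Derivation.leibniz Differential.mapCoeffs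
  have hC : ∀ r, d (C r) = C (MvPolynomial.pderiv (Sum.inr i) r) :=
    fun r => Differential.mapCoeffs_C r
  have hc : ∀ p : ℂ[X], d (p.map (MvPolynomial.C : ℂ →+* PairRing n)) = 0 := by
    intro p
    ext1 k
    rw [hcoeff, coeff_map, MvPolynomial.pderiv_C, coeff_zero]
  have hrow : ∀ k, d (genericRow M k) = 0 := by
    intro k
    rw [genericRow, map_sum]
    refine Finset.sum_eq_zero fun j _ => ?_
    rw [hmul, hc, hC, MvPolynomial.pderiv_X_of_ne (by simp)]
    simp
  refine ⟨d, hmul, ?_⟩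
  rw [genericForm, map_sum, Finset.sum_eq_single i]
  · rw [hmul, hrow, hC, MvPolynomial.pderiv_X_self]
    simp
  · intro k _ hk
    rw [hmul, hrow, hC, MvPolynomial.pderiv_X_of_ne (by simpa using hk)]
    simp
  · simp

theorem sum_mul_genericRow {M N : Matrix (Fin n) (Fin n) ℂ[X]} {p : ℂ[X]}
    (hNM : N * M = p • (1 : Matrix (Fin n) (Fin n) ℂ[X])) (k : Fin n) :
    ∑ i, (N k i).map MvPolynomial.C * genericRow M i =
      C (MvPolynomial.X (Sum.inl k)) * p.map (MvPolynomial.C : ℂ →+* PairRing n) := by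
  have h1 : ∀ j, ∑ i, N k i * M i j = if k = j then p else 0 := fun j => by
    rw [← Matrix.mul_apply, hNM, Matrix.smul_apply, Matrix.one_apply]
    simp
  simp only [genericRow, Finset.mul_sum]
  rw [Finset.sum_comm]
  have h2 : ∀ j, ∑ i, (N k i).map (MvPolynomial.C : ℂ →+* PairRing n) *
      (C (MvPolynomial.X (Sum.inl j)) * (M i j).map MvPolynomial.C) =
      C (MvPolynomial.X (Sum.inl j)) * (if k = j then p else 0).map MvPolynomial.C := by
    intro j
    rw [← h1 j, Polynomial.map_sum, Finset.mul_sum]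
    refine Finset.sum_congr rfl fun i _ => ?_
    rw [Polynomial.map_mul]
    ring
  rw [Finset.sum_congr rfl fun j _ => h2 j, Finset.sum_eq_single k]
  · simp
  · intro j _ hj
    simp [hj.symm]
  · simp

/-- The radical is the intersection of the primes above the ideal, each generated by one `π`. Then
`π ^ 2` divides the form, so `π` divides its partial derivatives, which are the rows of `M u`.
Multiplying by `N` gives `π ∣ p u_k`, and `u_k` is a nonzero constant over `K`. -/
theorem map_mem_radical (K : Type*) [Field K] [Algebra (PairRing n) K]
    [IsFractionRing (PairRing n) K] (hn : 0 < n) {M N : Matrix (Fin n) (Fin n) ℂ[X]} {p : ℂ[X]}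
    (hNM : N * M = p • (1 : Matrix (Fin n) (Fin n) ℂ[X])) :
    (p.map (MvPolynomial.C : ℂ →+* PairRing n)).map (algebraMap (PairRing n) K) ∈
      (Ideal.span {(genericForm M).map (algebraMap (PairRing n) K),
        derivative ((genericForm M).map (algebraMap (PairRing n) K))}).radical := by
  have hinj := IsFractionRing.injective (PairRing n) K
  have : CharZero K := charZero_of_injective_algebraMap hinj
  rw [Ideal.radical_eq_sInf, Submodule.mem_sInf]
  rintro 𝔭 ⟨hle, hprime⟩
  rw [Ideal.span_le, insert_subset_iff, singleton_subset_iff] at hle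
  obtain ⟨π, hπ⟩ := (IsPrincipalIdealRing.principal 𝔭).principal
  rw [← Ideal.span] at hπ
  subst hπ
  simp only [SetLike.mem_coe, Ideal.mem_span_singleton] at hle ⊢
  have hirr : π = 0 ∨ Irreducible π := by
    by_cases h0 : π = 0
    · exact .inl h0
    · exact .inr ((Ideal.span_singleton_prime h0).1 hprime).irreducible
  have hsq := sq_dvd_of_dvd_derivative hirr hle.1 hle.2
  have hrow : ∀ i, π ∣ (genericRow M i).map (algebraMap (PairRing n) K) := fun i => by
    obtain ⟨d, hmul, hd⟩ := exists_derivation_genericForm M i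
    rw [← hd]
    exact dvd_map_derivation_of_sq_dvd hmul hsq
  have h1 := congrArg (Polynomial.map (algebraMap (PairRing n) K)) (sum_mul_genericRow hNM ⟨0, hn⟩)
  rw [Polynomial.map_sum, Polynomial.map_mul, map_C] at h1
  have h2 : π ∣ C (algebraMap (PairRing n) K (MvPolynomial.X (Sum.inl ⟨0, hn⟩))) *
      (p.map (MvPolynomial.C : ℂ →+* PairRing n)).map (algebraMap (PairRing n) K) := by
    rw [← h1]
    refine Finset.dvd_sum fun i _ => ?_
    rw [Polynomial.map_mul]
    exact (hrow i).mul_left _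
  refine IsUnit.dvd_mul_left (isUnit_C.2 (isUnit_iff_ne_zero.2 ?_)) |>.1 h2
  exact (map_ne_zero_iff _ hinj).2 (MvPolynomial.X_ne_zero _)

/-- Membership in the radical is a Bézout identity `a F + b F' = p ^ N`. The generic polynomial is
the product of the denominators of `a` and `b`; where it is nonzero the identity specializes. -/
theorem exists_generic_no_double_zero (hn : 0 < n) {M N : Matrix (Fin n) (Fin n) ℂ[X]} {p : ℂ[X]}
    (hNM : N * M = p • (1 : Matrix (Fin n) (Fin n) ℂ[X])) :
    ∃ P : PairRing n, P ≠ 0 ∧ ∀ x, MvPolynomial.eval x P ≠ 0 → ∀ z : ℂ, p.eval z ≠ 0 →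
      (bilinForm M x).eval z = 0 → (derivative (bilinForm M x)).eval z ≠ 0 := by
  have hinj := IsFractionRing.injective (PairRing n) (FractionRing (PairRing n))
  obtain ⟨N, hN⟩ := map_mem_radical (FractionRing (PairRing n)) hn hNM
  set φ := algebraMap (PairRing n) (FractionRing (PairRing n)) with hφ
  obtain ⟨a, b, hab⟩ := Ideal.mem_span_pair.1 hN
  obtain ⟨r, hr, a₀, ha₀⟩ := exists_map_eq_C_mul (R := PairRing n) a
  obtain ⟨s, hs, b₀, hb₀⟩ := exists_map_eq_C_mul (R := PairRing n) b
  rw [← hφ] at ha₀ hb₀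
  have key : C (r * s) * p.map (MvPolynomial.C : ℂ →+* PairRing n) ^ N =
      C s * a₀ * genericForm M + C r * b₀ * derivative (genericForm M) := by
    apply map_injective φ hinj
    simp only [Polynomial.map_mul, Polynomial.map_add, Polynomial.map_pow, map_C, ha₀, hb₀,
      ← derivative_map, ← hab, map_mul]
    ring
  refine ⟨r * s, mul_ne_zero hr hs, fun x hx z hz h0 h1 => ?_⟩
  have h2 := congrArg (fun q => (q.map (MvPolynomial.eval x)).eval z) key
  have hid : (MvPolynomial.eval x).comp (MvPolynomial.C : ℂ →+* PairRing n) = RingHom.id ℂ := by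
    ext a
    simp
  simp only [Polynomial.map_mul, Polynomial.map_add, Polynomial.map_pow, ← derivative_map,
    map_genericForm, eval_add, eval_mul, h0, h1, mul_zero, add_zero, map_C, eval_C, eval_pow,
    Polynomial.map_map, hid, Polynomial.map_id] at h2
  exact mul_ne_zero hx (pow_ne_zero _ hz) h2

/-- The remainder modulo `g` is linear over `ℂ`, so each coefficient of the remainder of the form is
a polynomial in the vectors. -/
theorem exists_generic_not_dvd {M : Matrix (Fin n) (Fin n) ℂ[X]} {g : ℂ[X]} (hg : g.Monic)
    (hM : ¬ ∀ i j, g ∣ M i j) :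
    ∃ P : PairRing n, P ≠ 0 ∧ ∀ x, MvPolynomial.eval x P ≠ 0 → ¬ g ∣ bilinForm M x := by
  push Not at hM
  obtain ⟨i₀, j₀, hij⟩ := hM
  rw [← modByMonic_eq_zero_iff_dvd hg] at hij
  obtain ⟨l, hl⟩ : ∃ l, (M i₀ j₀ %ₘ g).coeff l ≠ 0 := by
    by_contra! h
    exact hij (Polynomial.ext h)
  set P : PairRing n := ∑ i, MvPolynomial.X (Sum.inr i) * ∑ j, MvPolynomial.X (Sum.inl j) *
    MvPolynomial.C ((M i j %ₘ g).coeff l) with hP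
  have heval : ∀ x, MvPolynomial.eval x P = (bilinForm M x %ₘ g).coeff l := by
    intro x
    have h1 : bilinForm M x %ₘ g = modByMonicHom g (bilinForm M x) := rfl
    have h2 : ∀ i, modByMonicHom g (C (x (Sum.inr i)) * ∑ j, C (x (Sum.inl j)) * M i j) =
        x (Sum.inr i) • ∑ j, x (Sum.inl j) • (M i j %ₘ g) := fun i => by
      rw [← smul_eq_C_mul, map_smul, map_sum]
      congr 1
      exact Finset.sum_congr rfl fun j _ => by rw [← smul_eq_C_mul, map_smul]; rfl
    rw [h1, bilinForm, map_sum (modByMonicHom g), Finset.sum_congr rfl fun i _ => h2 i]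
    simp [hP]
  refine ⟨P, fun h0 => ?_, fun x hx hdvd => ?_⟩
  · have h1 : MvPolynomial.eval (Sum.elim (Pi.single j₀ 1) (Pi.single i₀ 1)) P =
        (M i₀ j₀ %ₘ g).coeff l := by
      simp [hP, Pi.single_apply]
    rw [h0, map_zero] at h1
    exact hl h1.symm
  · rw [heval, (modByMonic_eq_zero_iff_dvd hg).2 hdvd, coeff_zero] at hx
    exact hx rfl

end Generic

end RankOne

end

noncomputable section

namespace RankOne

open Polynomial Matrix

/-! ### The level sets of the transfer function -/

section Level

variable {n : ℕ} (A : Matrix (Fin n) (Fin n) ℂ) (u v : Fin n → ℂ)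

theorem analyticAt_Qval {z : ℂ} (hz : Regular A u v z) : AnalyticAt ℂ (Qval A u v) z :=
  analyticAt_eval_div _ _ hz

theorem eventually_regular {z : ℂ} (hz : Regular A u v z) : ∀ᶠ w in 𝓝 z, Regular A u v w :=
  (Q A u v).denom.continuous.continuousAt.eventually_ne hz

theorem Qval_ne_zero_of_mem_level {t : ℝ} (ht : 0 < t) {z : ℂ} (hz : z ∈ level A u v t) :
    Qval A u v z ≠ 0 := by
  intro h0
  have := hz.2
  rw [h0] at this
  simp [ht.ne] at this

theorem eventually_mem_level_iff {t : ℝ} {z : ℂ} (hz : z ∈ level A u v t) :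
    ∀ᶠ w in 𝓝 z, w ∈ level A u v t ↔ ‖Qval A u v w‖ = ‖Qval A u v z‖ := by
  filter_upwards [eventually_regular A u v hz.1] with w hw
  have h1 : 1 / ‖Qval A u v z‖ = t := hz.2
  simp only [level, mem_ofPred_eq, hw, true_and]
  rw [← h1, one_div, one_div, _root_.inv_inj]

theorem isRegularLevel_level {t : ℝ} (ht : 0 < t)
    (hcrit : ∀ z ∈ critical A u v, t ≠ 1 / ‖Qval A u v z‖) :
    IsRegularLevel (Qval A u v) t⁻¹ (level A u v t) where
  pos := inv_pos.2 ht
  isCompact := by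
    rw [level_eq A u v ht]
    exact isCompact_levelSet (degree_num_lt A u v) t
  analyticAt z hz := analyticAt_Qval A u v hz.1
  deriv_ne_zero z hz h0 := hcrit z ⟨hz.1, h0⟩ hz.2.symm
  eventually_mem_iff z hz := by
    filter_upwards [eventually_mem_level_iff A u v hz] with w hw
    rw [hw, ← hz.2, one_div, inv_inv]

theorem analyticOrderAt_Qval_sub_ne_top (hQ : Q A u v ≠ 0) {z : ℂ} (hz : Regular A u v z) :
    analyticOrderAt (Qval A u v · - Qval A u v z) z ≠ ⊤ := by
  rw [Ne, analyticOrderAt_eq_top]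
  intro h
  refine not_eventually_div_eq (degree_num_lt A u v) (RatFunc.num_ne_zero hQ) hz
    (Qval A u v z) ?_
  filter_upwards [h] with w hw
  exact sub_eq_zero.1 hw

/-- `k` is the order of `Q - Q(z)`, so `Q'` vanishes to order `k - 1`. -/
theorem exists_localModel_level {t : ℝ} (ht : 0 < t) {z : ℂ} (hz : z ∈ level A u v t) :
    ∃ k : ℕ, k ≠ 0 ∧ (z ∈ critical A u v ↔ k ≠ 1) ∧ LocalModel (level A u v t) z k := by
  have h0 := Qval_ne_zero_of_mem_level A u v ht hz
  have hQ : Q A u v ≠ 0 := by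
    intro h
    simp [Qval, h] at h0
  have ha := analyticAt_Qval A u v hz.1
  obtain ⟨k, hk⟩ := ENat.ne_top_iff_exists.1 (analyticOrderAt_Qval_sub_ne_top A u v hQ hz.1)
  have hord := ha.analyticOrderAt_deriv_add_one
  have hk0 : k ≠ 0 := by
    rintro rfl
    rw [← hk] at hord
    simp at hord
  refine ⟨k, hk0, ?_, localModel_of_analyticAt ha h0 hk0 hk.symm
    (eventually_mem_level_iff A u v hz)⟩
  have h1 : z ∈ critical A u v ↔ deriv (Qval A u v) z = 0 := and_iff_right hz.1
  rw [h1, ← not_iff_not, not_not, ← ne_eq, ← ha.deriv.analyticOrderAt_eq_zero]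
  rw [← hk] at hord
  constructor
  · intro h
    rw [h, zero_add] at hord
    exact_mod_cast hord.symm
  · rintro rfl
    simpa using hord

theorem nonempty_sigma (hn : 0 < n) {t : ℝ} (ht : 0 < t) : (sigma A u v t).Nonempty := by
  have hd : (perturb A u v t).charpoly.degree ≠ 0 := by
    rw [charpoly_degree_eq_dim]
    simpa using hn.ne'
  obtain ⟨z, hz⟩ := IsAlgClosed.exists_root _ hd
  rw [charpoly_perturb, IsRoot, eval_sub, eval_mul, eval_C, sub_eq_zero] at hz
  refine ⟨z, ?_⟩
  rw [sigma_eq A u v ht, levelSet, mem_ofPred_eq, hz, norm_mul, Complex.norm_real,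
    Real.norm_eq_abs, abs_of_pos ht]

end Level

/-! ### Generic vectors -/

section Generic

variable {n : ℕ} (A : Matrix (Fin n) (Fin n) ℂ)

theorem transferNum_eq_bilinForm (u v : Fin n → ℂ) :
    transferNum A u v = bilinForm A.charmatrix.adjugate (Sum.elim u (star v)) := by
  simp only [transferNum, bilinForm, dotProduct, mulVec, Sum.elim_inl, Sum.elim_inr, Pi.star_apply]
  exact Finset.sum_congr rfl fun i _ => congrArg _ (Finset.sum_congr rfl fun j _ => mul_comm _ _)

/-- The matrix of the numerator of the derivative of the transfer function. -/
def derivMatrix : Matrix (Fin n) (Fin n) ℂ[X] :=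
  A.charpoly • A.charmatrix.adjugate.map derivative -
    derivative A.charpoly • A.charmatrix.adjugate

theorem bilinForm_derivMatrix (x : Fin n ⊕ Fin n → ℂ) :
    bilinForm (derivMatrix A) x =
      derivative (bilinForm A.charmatrix.adjugate x) * A.charpoly -
        bilinForm A.charmatrix.adjugate x * derivative A.charpoly := by
  simp only [bilinForm, derivMatrix, derivative_sum, derivative_C_mul, Finset.sum_mul,
    ← Finset.sum_sub_distrib, Finset.mul_sum, Matrix.sub_apply, Matrix.smul_apply, map_apply,
    smul_eq_mul]
  refine Finset.sum_congr rfl fun i _ => Finset.sum_congr rfl fun j _ => ?_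
  ring

theorem map_derivative_mul (M N : Matrix (Fin n) (Fin n) ℂ[X]) :
    (M * N).map derivative = M.map derivative * N + M * N.map derivative := by
  ext1 i j
  simp only [map_apply, Matrix.mul_apply, Matrix.add_apply, derivative_sum, derivative_mul,
    Finset.sum_add_distrib]

theorem charmatrix_map_derivative : A.charmatrix.map derivative = 1 := by
  ext1 i j
  by_cases h : i = j <;> simp [Matrix.one_apply, h]

theorem charmatrix_mul_adjugate :
    A.charmatrix * A.charmatrix.adjugate = A.charpoly • (1 : Matrix (Fin n) (Fin n) ℂ[X]) :=
  mul_adjugate _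

/-- Differentiate `(λ - A) adj = p`, using that `λ - A` has derivative the identity. -/
theorem charmatrix_mul_derivMatrix :
    A.charmatrix * derivMatrix A = -(A.charpoly • A.charmatrix.adjugate) := by
  have h1 := congrArg (fun M : Matrix (Fin n) (Fin n) ℂ[X] => M.map derivative)
    (charmatrix_mul_adjugate A)
  have h2 : (A.charpoly • (1 : Matrix (Fin n) (Fin n) ℂ[X])).map derivative =
      derivative A.charpoly • 1 := by
    ext1 i j
    by_cases h : i = j <;> simp [h]
  simp only [map_derivative_mul, charmatrix_map_derivative, h2, Matrix.one_mul] at h1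
  rw [derivMatrix, Matrix.mul_sub, Matrix.mul_smul, Matrix.mul_smul, charmatrix_mul_adjugate,
    eq_sub_of_add_eq' h1, smul_sub, smul_comm A.charpoly (derivative A.charpoly)]
  abel

/-- This puts the numerator of `Q'` in the form required by `exists_generic_no_double_zero`, with `p
^ 2` in place of `p`. -/
theorem neg_charmatrix_sq_mul_derivMatrix :
    -(A.charmatrix * A.charmatrix) * derivMatrix A =
      (A.charpoly ^ 2) • (1 : Matrix (Fin n) (Fin n) ℂ[X]) := by
  rw [Matrix.neg_mul, Matrix.mul_assoc, charmatrix_mul_derivMatrix, Matrix.mul_neg, neg_neg,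
    Matrix.mul_smul, charmatrix_mul_adjugate, smul_smul, sq]

/-- Otherwise dividing by the full power gives `(λ - A) B = s` with `s(z) ≠ 0`, contradicting `det
(z - A) = 0`. -/
theorem not_forall_pow_dvd_adjugate {z : ℂ} (hz : A.charpoly.eval z = 0) :
    ¬ ∀ i j, (X - C z) ^ A.charpoly.rootMultiplicity z ∣ A.charmatrix.adjugate i j := by
  intro h
  choose B hB using h
  obtain ⟨s, hs, hsz⟩ := exists_eq_pow_rootMultiplicity_mul_and_not_dvd A.charpoly
    A.charpoly_monic.ne_zero z
  set g := (X - C z) ^ A.charpoly.rootMultiplicity z with hg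
  have hg0 : g ≠ 0 := pow_ne_zero _ (X_sub_C_ne_zero z)
  have h1 : A.charmatrix * Matrix.of B = s • (1 : Matrix (Fin n) (Fin n) ℂ[X]) := by
    have h2 : A.charmatrix.adjugate = g • Matrix.of B := by
      ext1 i j
      exact hB i j
    have h3 := charmatrix_mul_adjugate A
    rw [h2, hs, Matrix.mul_smul, mul_smul] at h3
    ext1 i j
    exact mul_left_cancel₀ hg0 (congrFun (congrFun h3 i) j)
  have h4 := congrArg (fun p => p.eval z) (congrArg det h1)
  simp only [det_mul, eval_mul, det_smul, det_one, mul_one, eval_pow] at h4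
  change A.charpoly.eval z * _ = _ at h4
  rw [hz, zero_mul] at h4
  exact hsz (dvd_iff_isRoot.2 (eq_zero_of_pow_eq_zero h4.symm))

/-- If `Q` were regular at an eigenvalue, the whole power of `X - z` in `p` would sit in the common
factor and divide `q`. This is excluded generically at each of the finitely many eigenvalues. -/
theorem exists_generic_pole :
    ∃ P : PairRing n, P ≠ 0 ∧ ∀ u v : Fin n → ℂ,
      MvPolynomial.eval (Sum.elim u (star v)) P ≠ 0 → ∀ z, Regular A u v z →
        A.charpoly.eval z ≠ 0 := by
  have h1 : ∀ z ∈ A.charpoly.roots.toFinset, ∃ P : PairRing n, P ≠ 0 ∧ ∀ x,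
      MvPolynomial.eval x P ≠ 0 → ¬ (X - C z) ^ A.charpoly.rootMultiplicity z ∣
        bilinForm A.charmatrix.adjugate x := fun z hz =>
    exists_generic_not_dvd ((monic_X_sub_C z).pow _)
      (not_forall_pow_dvd_adjugate A (by simpa [A.charpoly_monic.ne_zero] using hz))
  choose! P hP0 hP using h1
  refine ⟨∏ z ∈ A.charpoly.roots.toFinset, P z, Finset.prod_ne_zero_iff.2 hP0,
    fun u v hx z hz h0 => ?_⟩
  have hz' : z ∈ A.charpoly.roots.toFinset := by simpa [A.charpoly_monic.ne_zero] using h0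
  rw [map_prod, Finset.prod_ne_zero_iff] at hx
  refine hP z hz' _ (hx z hz') ?_
  rw [← transferNum_eq_bilinForm]
  obtain ⟨g, -, hg1, hg2⟩ := exists_common_factor A u v
  have hco : IsCoprime ((X - C z) ^ A.charpoly.rootMultiplicity z) (Q A u v).denom := by
    refine IsCoprime.pow_left ?_
    rw [(irreducible_X_sub_C z).coprime_iff_not_dvd, dvd_iff_isRoot]
    exact hz
  rw [hg2]
  refine Dvd.dvd.mul_left (hco.dvd_of_dvd_mul_left ?_) _
  rw [← hg1]
  exact pow_rootMultiplicity_dvd _ _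

/-- The nondegeneracy of the critical points of `Q` that holds for generic vectors. -/
def Nondegenerate (u v : Fin n → ℂ) : Prop :=
  ∀ z, Regular A u v z → A.charpoly.eval z ≠ 0 ∧
    ((transferNum A u v).eval z = 0 → (derivative (transferNum A u v)).eval z ≠ 0) ∧
    ((derivative (transferNum A u v) * A.charpoly -
        transferNum A u v * derivative A.charpoly).eval z = 0 →
      (derivative (derivative (transferNum A u v) * A.charpoly -
        transferNum A u v * derivative A.charpoly)).eval z ≠ 0)

theorem exists_generic_nondegenerate (hn : 0 < n) :
    ∃ P : PairRing n, P ≠ 0 ∧ ∀ u v : Fin n → ℂ,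
      MvPolynomial.eval (Sum.elim u (star v)) P ≠ 0 → Nondegenerate A u v := by
  obtain ⟨P₁, h₁, hP₁⟩ := exists_generic_pole A
  obtain ⟨P₂, h₂, hP₂⟩ := exists_generic_no_double_zero hn (charmatrix_mul_adjugate A)
  obtain ⟨P₃, h₃, hP₃⟩ := exists_generic_no_double_zero hn (neg_charmatrix_sq_mul_derivMatrix A)
  refine ⟨P₁ * P₂ * P₃, mul_ne_zero (mul_ne_zero h₁ h₂) h₃, fun u v hx z hz => ?_⟩
  rw [map_mul, map_mul, mul_ne_zero_iff, mul_ne_zero_iff] at hx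
  have hp := hP₁ u v hx.1.1 z hz
  have e3 := hP₃ _ hx.2 z (by simpa using hp)
  rw [bilinForm_derivMatrix, ← transferNum_eq_bilinForm] at e3
  have e2 := hP₂ _ hx.1.2 z hp
  rw [← transferNum_eq_bilinForm] at e2
  exact ⟨hp, e2, e3⟩

/-! ### Consequences of nondegeneracy at critical points. -/

variable {A} {u v : Fin n → ℂ}

theorem Qval_eq_transferNum_div {z : ℂ} (hz : A.charpoly.eval z ≠ 0) :
    Qval A u v z = (transferNum A u v).eval z / A.charpoly.eval z := by
  obtain ⟨g, -, h1, h2⟩ := exists_common_factor A u v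
  rw [h1, eval_mul] at hz
  rw [h1, h2, eval_mul, eval_mul, mul_div_mul_right _ _ (right_ne_zero_of_mul hz), Qval_eq_div]

theorem eventuallyEq_Qval {z : ℂ} (hz : A.charpoly.eval z ≠ 0) : Qval A u v =ᶠ[𝓝 z]
    fun w => (transferNum A u v).eval w / A.charpoly.eval w := by
  filter_upwards [A.charpoly.continuous.continuousAt.eventually_ne hz] with w hw
  exact Qval_eq_transferNum_div hw

theorem hasDerivAt_eval_div (p q : ℂ[X]) {z : ℂ} (hz : p.eval z ≠ 0) :
    HasDerivAt (fun w => q.eval w / p.eval w)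
      ((derivative q * p - q * derivative p).eval z / p.eval z ^ 2) z := by
  rw [eval_sub, eval_mul, eval_mul]
  exact (q.hasDerivAt z).div (p.hasDerivAt z) hz

theorem deriv_Qval {z : ℂ} (hz : A.charpoly.eval z ≠ 0) :
    deriv (Qval A u v) z = (derivative (transferNum A u v) * A.charpoly -
        transferNum A u v * derivative A.charpoly).eval z / A.charpoly.eval z ^ 2 := by
  rw [(eventuallyEq_Qval hz).deriv_eq, (hasDerivAt_eval_div _ _ hz).deriv]

theorem deriv_deriv_Qval {z : ℂ} (hz : A.charpoly.eval z ≠ 0)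
    (h0 : (derivative (transferNum A u v) * A.charpoly -
        transferNum A u v * derivative A.charpoly).eval z = 0) :
    deriv (deriv (Qval A u v)) z = (derivative (derivative (transferNum A u v) * A.charpoly -
        transferNum A u v * derivative A.charpoly)).eval z / A.charpoly.eval z ^ 2 := by
  have h1 : deriv (Qval A u v) =ᶠ[𝓝 z] fun w => (derivative (transferNum A u v) * A.charpoly -
        transferNum A u v * derivative A.charpoly).eval w / (A.charpoly ^ 2).eval w := by
    filter_upwards [A.charpoly.continuous.continuousAt.eventually_ne hz] with w hw
    rw [deriv_Qval hw, eval_pow]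
  rw [h1.deriv_eq, (hasDerivAt_eval_div _ _ (by simpa using hz)).deriv, eval_sub, eval_mul,
    eval_mul, h0, zero_mul, sub_zero, sq (eval z (A.charpoly ^ 2)), mul_div_mul_right _ _
    (by simpa using hz), eval_pow]

/-- If `q` vanished at a critical point, `q' p - q p' = 0` would give `q' = 0` as well, a double
zero of `q`. -/
theorem Nondegenerate.Qval_ne_zero (h : Nondegenerate A u v) {z : ℂ} (hz : z ∈ critical A u v) :
    (transferNum A u v).eval z ≠ 0 ∧ Qval A u v z ≠ 0 := by
  obtain ⟨hp, h2, h3⟩ := h z hz.1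
  have hq : (transferNum A u v).eval z ≠ 0 := by
    intro h0
    have h4 := hz.2
    rw [deriv_Qval hp, div_eq_zero_iff, or_iff_left (pow_ne_zero 2 hp)] at h4
    simp only [eval_sub, eval_mul, h0, zero_mul, sub_zero, mul_eq_zero, hp, or_false] at h4
    exact h2 h0 h4
  rw [Qval_eq_transferNum_div hp]
  exact ⟨hq, div_ne_zero hq hp⟩

/-- Put `W = q' p - q p'` and `τ = p(z) / q(z)`. At `z`, the first and second derivatives of `p - τ
q` are `-W / q` and `-W' / q`; the former vanishes and the latter does not. -/
theorem Nondegenerate.rootMultiplicity_eq_two (h : Nondegenerate A u v) {z : ℂ}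
    (hz : z ∈ critical A u v) :
    (perturb A u v (1 / Qval A u v z)).charpoly.rootMultiplicity z = 2 := by
  obtain ⟨hp, -, h3⟩ := h z hz.1
  have hq := (h.Qval_ne_zero hz).1
  have hW := hz.2
  rw [deriv_Qval hp, div_eq_zero_iff, or_iff_left (pow_ne_zero 2 hp)] at hW
  have hW' := h3 hW
  simp only [eval_sub, eval_mul] at hW
  simp only [derivative_sub, derivative_mul, eval_sub, eval_add, eval_mul] at hW'
  have hne := (perturb A u v (1 / Qval A u v z)).charpoly_monic.ne_zero
  rw [Qval_eq_transferNum_div hp, one_div_div] at hne ⊢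
  apply le_antisymm
  · rw [← not_lt, lt_rootMultiplicity_iff_isRoot_iterate_derivative hne]
    intro hroot
    have h4 := hroot 2 le_rfl
    rw [charpoly_perturb] at h4
    simp only [Function.iterate_succ, Function.iterate_zero, Function.comp_apply, id, IsRoot,
      derivative_sub, derivative_C_mul, eval_sub, eval_mul, eval_C] at h4
    apply hW'
    field_simp at h4
    linear_combination -h4
  · refine (one_lt_rootMultiplicity_iff_isRoot hne).2 ⟨?_, ?_⟩
    · rw [charpoly_perturb, IsRoot, eval_sub, eval_mul, eval_C, div_mul_cancel₀ _ hq, sub_self]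
    · rw [charpoly_perturb, IsRoot, derivative_sub, derivative_C_mul, eval_sub, eval_mul, eval_C]
      field_simp
      linear_combination -hW

/-- Since `p(z) ≠ 0`, near `z` the set is the plain level set of `|Q|`; since `Q'` has a simple
zero, the order of `Q - Q(z)` is two. -/
theorem Nondegenerate.localModel_sigma (h : Nondegenerate A u v) {z : ℂ}
    (hz : z ∈ critical A u v) :
    LocalModel (sigma A u v (1 / ‖Qval A u v z‖)) z 2 := by
  obtain ⟨hp, -, h3⟩ := h z hz.1
  have hQ := (h.Qval_ne_zero hz).2
  have ha := analyticAt_Qval A u v hz.1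
  have hW := hz.2
  rw [deriv_Qval hp, div_eq_zero_iff, or_iff_left (pow_ne_zero 2 hp)] at hW
  have hd2 : deriv (deriv (Qval A u v)) z ≠ 0 := by
    rw [deriv_deriv_Qval hp hW]
    exact div_ne_zero (h3 hW) (pow_ne_zero 2 hp)
  have hord := ha.analyticOrderAt_deriv_add_one
  rw [ha.deriv.analyticOrderAt_eq_one_of_zero_deriv_ne_zero hz.2 hd2] at hord
  refine localModel_of_analyticAt ha hQ two_ne_zero (by rw [← hord]; norm_num) ?_
  have ht : 0 < 1 / ‖Qval A u v z‖ := by positivity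
  filter_upwards [A.charpoly.continuous.continuousAt.eventually_ne hp] with w hw
  rw [sigma_eq A u v ht, mem_levelSet_iff_div ht hw, ← Qval_eq_transferNum_div hw, one_div, inv_inv]

end Generic

end RankOne

end

theorem mainTheorem3 {n : ℕ} (hn : 0 < n) (A : Matrix (Fin n) (Fin n) ℂ) :
    (∀ u v : Fin n → ℂ, u ≠ 0 → v ≠ 0 →
      -- up to the frozen eigenvalues, the sets are the level sets, which are algebraic curves
      (∀ t : ℝ, 0 < t →
        RankOne.sigma A u v t = RankOne.level A u v t ∪ RankOne.frozen A u v ∧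
        RankOne.IsAlgebraicCurve (RankOne.level A u v t)) ∧
      -- (i) regular values: disjoint smooth closed curves
      (∀ t : ℝ, 0 < t → (∀ z ∈ RankOne.critical A u v, t ≠ 1 / ‖RankOne.Qval A u v z‖) →
        ∃ (k : ℕ) (C : Fin k → Set ℂ), (∀ j, RankOne.IsSmoothClosedCurve (C j)) ∧
          (∀ i j, i ≠ j → Disjoint (C i) (C j)) ∧ RankOne.level A u v t = ⋃ j, C j) ∧
      -- (ii) any value, in particular a critical one: the level set is locally an interval,
      -- except at the zeros of `Q'` on it, which are intersection points
      (∀ t : ℝ, 0 < t → ∀ z ∈ RankOne.level A u v t,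
        (z ∉ RankOne.critical A u v → RankOne.IsLocallyInterval (RankOne.level A u v t) z) ∧
        (z ∈ RankOne.critical A u v → RankOne.IsCrossing (RankOne.level A u v t) z)) ∧
      -- (iv) covering of the plane
      spectrum ℂ A ∪ (⋃ t ∈ Set.Ioi (0 : ℝ), RankOne.sigma A u v t) ∪ RankOne.zerosQ A u v
        = Set.univ ∧
      -- (v) continuity in the Hausdorff metric
      (∀ t : ℝ, 0 < t → IsCompact (RankOne.sigma A u v t) ∧ (RankOne.sigma A u v t).Nonempty ∧
        Filter.Tendsto
          (fun s => Metric.hausdorffEDist (RankOne.sigma A u v s) (RankOne.sigma A u v t))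
          (nhds t) (nhds 0)) ∧
      -- (vi) the limit as `t → ∞`
      (RankOne.Q A u v ≠ 0 →
        RankOne.TendstoOnSphere (fun t => (↑) '' RankOne.level A u v t)
          ((↑) '' RankOne.zerosQ A u v ∪ {OnePoint.infty}) ∧
        RankOne.TendstoOnSphere (fun t => (↑) '' RankOne.sigma A u v t)
          ((↑) '' (RankOne.zerosQ A u v ∪ RankOne.frozen A u v) ∪ {OnePoint.infty}))) ∧
    -- (iii) generic vectors: right angles at double eigenvalues
    RankOne.ForGeneric (fun u v : Fin n → ℂ =>
      ∀ z ∈ RankOne.critical A u v,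
        RankOne.Qval A u v z ≠ 0 ∧
        (RankOne.perturb A u v (1 / RankOne.Qval A u v z)).charpoly.rootMultiplicity z = 2 ∧
        RankOne.IsRightAngleMeeting
          (RankOne.sigma A u v (1 / ‖RankOne.Qval A u v z‖)) z) := by
  refine ⟨fun u v _ _ => ⟨fun t ht => ⟨RankOne.sigma_eq_level_union_frozen A u v ht, ?_⟩,
    fun t ht hcrit => (RankOne.isRegularLevel_level A u v ht hcrit).exists_smoothClosedCurves,
    fun t ht z hz => ?_, RankOne.spectrum_union_sigma_union_zerosQ A u v, fun t ht => ⟨?_,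
      RankOne.nonempty_sigma A u v hn ht, ?_⟩, fun hQ => ⟨?_, ?_⟩⟩, ?_⟩
  · rw [RankOne.level_eq A u v ht]
    exact RankOne.isAlgebraicCurve_levelSet (RankOne.degree_num_lt A u v) ht
  · obtain ⟨k, hk0, hk, hmodel⟩ := RankOne.exists_localModel_level A u v ht hz
    refine ⟨fun hc => ?_, fun hc => hmodel.isCrossing ?_⟩
    · obtain rfl : k = 1 := by
        by_contra h
        exact hc (hk.2 h)
      exact hmodel.isLocallyInterval
    · have := hk.1 hc
      omega
  · rw [RankOne.sigma_eq A u v ht]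
    exact RankOne.isCompact_levelSet (RankOne.degree_transferNum_lt A u v) t
  · refine (RankOne.tendsto_hausdorffEDist_levelSet
      (RankOne.degree_transferNum_lt A u v) ht).congr' ?_
    filter_upwards [eventually_gt_nhds ht] with s hs
    rw [RankOne.sigma_eq A u v ht, RankOne.sigma_eq A u v hs]
  · rw [RankOne.zerosQ_eq]
    refine (RankOne.tendstoOnSphere_levelSet (RankOne.degree_num_lt A u v)
      (RatFunc.num_ne_zero hQ)).congr' ?_
    filter_upwards [Filter.eventually_gt_atTop 0] with t ht
    rw [RankOne.level_eq A u v ht]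
  · rw [RankOne.zerosQ_union_frozen]
    refine (RankOne.tendstoOnSphere_levelSet (RankOne.degree_transferNum_lt A u v)
      (mt (RankOne.Q_eq_zero_iff A u v).2 hQ)).congr' ?_
    filter_upwards [Filter.eventually_gt_atTop 0] with t ht
    rw [RankOne.sigma_eq A u v ht]
  · obtain ⟨P, hP0, hP⟩ := RankOne.exists_generic_nondegenerate A hn
    refine ⟨P, hP0, fun u v hnot => ?_⟩
    by_contra hne
    have hnd := hP u v hne
    exact hnot fun z hz => ⟨(hnd.Qval_ne_zero hz).2, hnd.rootMultiplicity_eq_two hz,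
      (hnd.localModel_sigma hz).isRightAngleMeeting⟩
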